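/- \textbf{Setting.} Let $p_{Y|X}$ be a memoryless channel with input alphabet $[0,1]$ and an arbitrary measurable output space. The admissible inputs are the piecewise continuous probability densities $p_X$ on $[0,1]$ with $p_X(x)\le c_{\max}$ for all $x$. Assume that the unconstrained capacity $C_{\max}=\sup_{p_X} I(X;Y)$ over the admissible inputs is finite. For a harvesting function $\beta:[0,1]\to\mathbb R$ let $$C_\beta(B)=\sup_{p_X:\ \mathbb E[\beta(X)]\ge B} I(X;Y)$$ be the capacity-energy function, with value $0$ if no admissible input delivers energy $B$, and let $B_{\max}=\sup_{p_X}\mathbb E[\beta(X)]$. Let $\mathsf{BV}_K[0,1]$ be the set of functions on $[0,1]$ of total variation at most $K$. Let $m=2^J$, let $x_i=i/(m-1)$ (or $x_i=i/m$) for $i=0,\dots,m-1$, and let $Y_i=\beta(x_i)+Z_i$ with $Z_i$ i.i.d. $\mathcal N(0,\sigma^2)$, $\sigma>0$. Let $\phi,\psi$ be a compactly supported father and mother wavelet of an orthonormal multiresolution analysis of $L_2(\mathbb R)$, with $\int\psi=0$. Put $f_{j,k}(x)=2^{j/2}f(2^jx-k)$ for $f\in\{\phi,\psi\}$, and pass to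 $[0,1]$ by periodization, $f^{\mathrm{per}}_{j,k}(x)=\sum_{l\in\mathbb Z}f_{j,k}(x+l)$; for the Haar wavelet and $0\le k<2^j$ this changes nothing almost everywhere. The wavelet reconstruction $\widehat\beta_m^{\mathsf{wv}}$ is the combination of the $m$ functions $e\in\{\phi^{\mathrm{per}}_{0,0}\}\cup\{\psi^{\mathrm{per}}_{j,k}:0\le j<J,\ 0\le k<2^j\}$ with coefficients $$\widehat\theta_e=\operatorname{sign}(y_e)\max(|y_e|-\lambda,0),\qquad y_e=\int_0^1 f_Y(x)\,e(x)\,dx,\qquad \lambda=\sqrt{2\tfrac{\sigma^2}{m}\log m},$$ where $f_Y$ is the step function equal to $Y_i$ on $[i/m,(i+1)/m)$. The expected information loss over the sampling noise is $$\overline\Delta_{\mathsf I}(B;\beta,\widehat\beta_m^{\mathsf{wv}})=\mathbb E\left[\,|C_\beta(B)-C_{\widehat\beta_m^{\mathsf{wv}}}(B)|\,\right].$$ \textbf{Theorem.} For every $\beta\in\mathsf{BV}_K[0,1]$ and every $B\in[0,B_{\max})$, this expectation is well defined for every $m=2^J$ and $$\overline\Delta_{\mathsf I}(B;\beta,\widehat\beta_m^{\mathsf{wv}})\to0\quad\text{as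 } m=2^J\to\infty .$$ However, this fails at $B=B_{\max}$ in general: if $C_{\max}>0$, there is a nonnegative $\beta\in\mathsf{BV}_K[0,1]$ for which $\overline\Delta_{\mathsf I}(B_{\max};\beta,\widehat\beta_m^{\mathsf{wv}})$ is at least some constant $c>0$ for all sufficiently large $m=2^J$. -/

import Mathlib

open MeasureTheory ProbabilityTheory Filter Topology
open scoped NNReal ENNReal unitInterval

noncomputable section

namespace SIET

/-! ### Functions of bounded variation on the input alphabet `[0,1]` -/

/-- `BV_K[0,1]`: real functions on `[0,1]` of total variation at most `K`. -/
def BV (K : ℝ≥0) : Set (I → ℝ) := {f | eVariationOn f Set.univ ≤ K}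

/-! ### Admissible input distributions, energy, mutual information, capacity -/

/-- Piecewise continuity on `[0,1]`: continuous off a finite set, with finite one-sided limits at
the exceptional points (the one-sided filter is trivial where there is no such side). -/
def PiecewiseContinuous (p : I → ℝ) : Prop :=
  ∃ F : Finset I, ContinuousOn p ((F : Set I)ᶜ) ∧
    ∀ x ∈ F, (∃ l, Tendsto p (𝓝[<] x) (𝓝 l)) ∧ (∃ l, Tendsto p (𝓝[>] x) (𝓝 l))

/-- Admissible input densities: piecewise continuous probability densities on `[0,1]` that are
bounded by `cmax`. -/
def Admissible (cmax : ℝ) : Set (I → ℝ) :=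
  {p | PiecewiseContinuous p ∧ (∀ x, 0 ≤ p x) ∧ (∀ x, p x ≤ cmax) ∧ ∫ x, p x = 1}

/-- The law `p_X` of the channel input with density `p`. -/
def inputLaw (p : I → ℝ) : Measure I := volume.withDensity fun x => ENNReal.ofReal (p x)

/-- The delivered energy `E[β(X)]`. -/
def energy (β p : I → ℝ) : ℝ := ∫ x, β x ∂(inputLaw p)

/-- Mutual information `I(X;Y)` (in nats), for input law `μ` and channel `κ = p_{Y|X}`: the
divergence of the joint law of `(X,Y)` from the product of its marginals. -/
def mutualInfo {𝒴 : Type*} [MeasurableSpace 𝒴] (κ : Kernel I 𝒴) (μ : Measure I) : ℝ≥0∞ :=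
  InformationTheory.klDiv (μ ⊗ₘ κ) (μ.prod (κ ∘ₘ μ))

/-- The capacity-energy function `C_β(B)`; it is `0` if no admissible input delivers energy `B`. -/
def capacity {𝒴 : Type*} [MeasurableSpace 𝒴] (κ : Kernel I 𝒴) (cmax : ℝ) (β : I → ℝ) (B : ℝ) :
    ℝ≥0∞ :=
  ⨆ p ∈ {p | p ∈ Admissible cmax ∧ B ≤ energy β p}, mutualInfo κ (inputLaw p)

/-- The unconstrained capacity `C_max`. -/
def maxCapacity {𝒴 : Type*} [MeasurableSpace 𝒴] (κ : Kernel I 𝒴) (cmax : ℝ) : ℝ≥0∞ :=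
  ⨆ p ∈ Admissible cmax, mutualInfo κ (inputLaw p)

/-- The maximal deliverable energy `B_max` of the harvesting function `β`. -/
def maxEnergy (cmax : ℝ) (β : I → ℝ) : ℝ := sSup (energy β '' Admissible cmax)

/-! ### Wavelets -/

/-- The dilated translate `f_{j,k}(x) = 2^{j/2} f(2^j x - k)`. -/
def dilate (f : ℝ → ℝ) (j k : ℤ) (x : ℝ) : ℝ := (2 : ℝ) ^ ((j : ℝ) / 2) * f ((2 : ℝ) ^ j * x - k)

/-- The closed linear span in `L²(ℝ)` of `f_{j,k}`, `k ∈ ℤ`. -/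
def scaleSpace (f : ℝ → ℝ) (j : ℤ) : Submodule ℝ (Lp ℝ 2 (volume : Measure ℝ)) :=
  (Submodule.span ℝ {g : Lp ℝ 2 (volume : Measure ℝ) |
    ∃ k : ℤ, (g : ℝ → ℝ) =ᵐ[volume] dilate f j k}).topologicalClosure

/-- `φ` is the father wavelet of a multiresolution analysis of `L²(ℝ)` with the scale spaces `V_j`,
and `ψ` is a mother wavelet for it; both have compact support, and `ψ` has a vanishing moment. -/
structure IsWavelet (φ ψ : ℝ → ℝ) : Prop where
  memLp_father : MemLp φ 2 volume
  memLp_mother : MemLp ψ 2 volume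
  compact_father : HasCompactSupport φ
  compact_mother : HasCompactSupport ψ
  vanishing_moment : ∫ x, ψ x = 0
  /-- the `φ_{j,k}` of one scale are orthonormal -/
  orthonormal_father : ∀ j k k' : ℤ,
    ∫ x, dilate φ j k x * dilate φ j k' x = if k = k' then 1 else 0
  /-- the `ψ_{j,k}` of all scales are orthonormal -/
  orthonormal_mother : ∀ j k j' k' : ℤ,
    ∫ x, dilate ψ j k x * dilate ψ j' k' x = if j = j' ∧ k = k' then 1 else 0
  nested : ∀ j, scaleSpace φ j ≤ scaleSpace φ (j + 1)
  inter : ⨅ j, scaleSpace φ j = ⊥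
  dense : (⨆ j, scaleSpace φ j).topologicalClosure = ⊤
  /-- the `ψ_{j,k}` span the orthogonal complement `W_j` of `V_j` in `V_{j+1}` -/
  detail : ∀ j, scaleSpace ψ j = scaleSpace φ (j + 1) ⊓ (scaleSpace φ j)ᗮ

/-- The `1`-periodization of `f_{j,k}`, restricted to `[0,1]`. For the Haar wavelet this is the
restriction of `f_{j,k}` itself (almost everywhere) if `0 ≤ k < 2 ^ j`. -/
def periodic (f : ℝ → ℝ) (j k : ℕ) (x : I) : ℝ := ∑' l : ℤ, dilate f j k (x + l)

/-! ### Reconstruction from `m` noisy samples -/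

/-- The grid `i / (m - 1)`, `i = 0, …, m - 1`. -/
def regularGrid (m : ℕ) (i : Fin m) : I :=
  ⟨(i : ℝ) / ((m : ℝ) - 1), by
    have h : (i : ℝ) + 1 ≤ m := by exact_mod_cast i.isLt
    have h0 : (0 : ℝ) ≤ i := Nat.cast_nonneg _
    exact ⟨div_nonneg h0 (by linarith), div_le_one_of_le₀ (by linarith) (by linarith)⟩⟩

/-- The grid `i / m`, `i = 0, …, m - 1`. -/
def dyadicGrid (m : ℕ) (i : Fin m) : I :=
  ⟨(i : ℝ) / (m : ℝ), by
    have h : (i : ℝ) + 1 ≤ m := by exact_mod_cast i.isLt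
    have h0 : (0 : ℝ) ≤ i := Nat.cast_nonneg _
    exact ⟨div_nonneg h0 (by linarith), div_le_one_of_le₀ (by linarith) (by linarith)⟩⟩

/-- The law of the noise `(Z_0, …, Z_{m-1})`: i.i.d. Gaussian, mean `0`, variance `sd²`. -/
def noise (sd : ℝ≥0) (m : ℕ) : Measure (Fin m → ℝ) := Measure.pi fun _ => gaussianReal 0 (sd ^ 2)

/-- The step function on `[0,1]` with value `Y_i` on `[i/m, (i+1)/m)`. -/
def step {m : ℕ} (Y : Fin m → ℝ) (x : I) : ℝ :=
  ∑ i : Fin m, Set.indicator (Set.Ico ((i : ℝ) / m) (((i : ℝ) + 1) / m)) (fun _ => Y i) (x : ℝ)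

/-- Soft thresholding of `y` at level `t`. -/
def soft (t y : ℝ) : ℝ := Real.sign y * max (|y| - t) 0

/-- The threshold `√(2 (sd²/m) log m)` for `m` coefficients with noise of variance `sd²/m`. -/
def threshold (sd : ℝ≥0) (m : ℕ) : ℝ := √(2 * ((sd : ℝ) ^ 2 / m) * Real.log m)

/-- Soft-thresholded estimate of the coefficient of the basis function `e`, from the samples `Y`. -/
def coeff (sd : ℝ≥0) {m : ℕ} (Y : Fin m → ℝ) (e : I → ℝ) : ℝ :=
  soft (threshold sd m) (∫ x, step Y x * e x)

/-- Wavelet reconstruction at scale `J` from `m = 2 ^ J` samples `Y` by soft-thresholding of the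
`m` coefficients. -/
def reconstruct (φ ψ : ℝ → ℝ) (sd : ℝ≥0) (J : ℕ) (Y : Fin (2 ^ J) → ℝ) (x : I) : ℝ :=
  coeff sd Y (periodic φ 0 0) * periodic φ 0 0 x +
    ∑ j ∈ Finset.range J, ∑ k ∈ Finset.range (2 ^ j),
      coeff sd Y (periodic ψ j k) * periodic ψ j k x

/-- The information loss `|C_β(B) - C_β̂(B)|` when the sampling noise is `z` and `β̂` is the wavelet
reconstruction from the noisy samples `β(x_i) + z_i` on the grid `x`. -/
def infoLoss {𝒴 : Type*} [MeasurableSpace 𝒴] (κ : Kernel I 𝒴) (cmax : ℝ)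
    (φ ψ : ℝ → ℝ) (sd : ℝ≥0) (x : ∀ m : ℕ, Fin m → I) (β : I → ℝ) (B : ℝ) (J : ℕ)
    (z : Fin (2 ^ J) → ℝ) : ℝ :=
  |(capacity κ cmax β B).toReal -
    (capacity κ cmax (reconstruct φ ψ sd J fun i => β (x (2 ^ J) i) + z i) B).toReal|

/-- The expected information loss `E|C_β(B) - C_β̂(B)|` over the sampling noise, `m = 2 ^ J`. -/
def expectedInfoLoss {𝒴 : Type*} [MeasurableSpace 𝒴] (κ : Kernel I 𝒴) (cmax : ℝ)
    (φ ψ : ℝ → ℝ) (sd : ℝ≥0) (x : ∀ m : ℕ, Fin m → I) (β : I → ℝ) (B : ℝ) (J : ℕ) : ℝ :=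
  ∫ z, infoLoss κ cmax φ ψ sd x β B J z ∂(noise sd (2 ^ J))

end SIET

end

noncomputable section

namespace SIET

/-! ### Mutual information of a mixture -/

/-! Convergence below the maximal energy combines a deterministic continuity property of the
capacity-energy function with consistency of the wavelet estimator.

Continuity rests on mixing. Since B lies below the maximal energy, some admissible q delivers
strictly more than B. Replacing p by (1-t)p + tq gains energy proportional to the slack of q and
keeps at least the fraction 1-t of the information, because divergence from a product law is an
integral of a nonnegative function and therefore monotone in the measure (`mul_mutualInfo_le`). The
bound on the densities turns an L¹ error in β into a uniform error in energy (`abs_energy_sub_le`).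
A small L¹ error is thus paid for by a small t, at a cost of at most t times the maximal capacity,
in both directions (`abs_capacity_sub_le`).

Consistency holds in L², hence in L¹. With m coefficients, each Gaussian of variance at most sd²/m,
the sharp Gaussian tail and a union bound show that with probability tending to 1 all noise
coefficients stay below the threshold; independence of the coefficients is not needed. On that event
soft thresholding costs at most a truncated sum of squared coefficients, which vanishes by dominated
convergence (`IsWavelet.tendsto_truncatedEnergy`). The sampling error is at most K²/m by bounded
variation (`BV.integral_step_sub_sq_le`), and the projection error vanishes because the periodized
wavelets are a Hilbert basis of L²[0,1] (`IsWavelet.ae_eq_zero_of_orthogonal`). Off the event the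
loss is at most the maximal capacity.

The expectation is well defined although the capacity is a supremum over uncountably many inputs: on
each of finitely many regions the sublevel sets in the noise are convex, hence Lebesgue null
measurable, and Gaussian noise is absolutely continuous.

At the maximal energy take β = 1. Every input is feasible for β, but thresholding shrinks the
reconstruction to a constant below 1 on the small-noise event, so no input remains feasible and the
whole capacity is lost. -/

open InformationTheory in
/-- The divergence from a product of marginals is minimal among products with the same first
factor. -/
lemma klDiv_prod_snd_le {α β : Type*} [MeasurableSpace α] [StandardBorelSpace α] [Nonempty α]
    [MeasurableSpace β] (P : Measure (α × β)) [IsProbabilityMeasure P] (μ : Measure α)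
    [IsProbabilityMeasure μ] (ν : Measure β) [IsProbabilityMeasure ν] :
    klDiv P (μ.prod P.snd) ≤ klDiv P (μ.prod ν) := by
  -- The coordinates are swapped because the output space is arbitrary: a conditional kernel is
  -- available only into the standard Borel factor.
  set Q : Measure (β × α) := P.map Prod.swap with hQ
  have hQP : P = Q.map Prod.swap := by
    rw [hQ, Measure.map_map measurable_swap measurable_swap]; simp
  have : IsProbabilityMeasure Q := Measure.isProbabilityMeasure_map measurable_swap.aemeasurable
  have hfst : Q.fst = P.snd := by
    rw [hQ, Measure.fst_map_swap]
  have hdis : Q.fst ⊗ₘ Q.condKernel = Q := Q.disintegrate Q.condKernel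
  have key : klDiv Q (Q.fst.prod μ) ≤ klDiv Q (ν.prod μ) := by
    -- Chain rule: the second summand is the divergence from the product of `Q.fst` and `μ`, and the
    -- first, `klDiv Q.fst ν`, is nonnegative.
    have h := klDiv_compProd_eq_add Q.fst ν Q.condKernel (Kernel.const β μ)
    rw [hdis, Measure.compProd_const, Measure.compProd_const] at h
    rw [h]
    exact le_add_self
  calc klDiv P (μ.prod P.snd) = klDiv (Q.map Prod.swap) ((Q.fst.prod μ).map Prod.swap) := by
        rw [← hQP, Measure.prod_swap, hfst]
    _ ≤ klDiv Q (Q.fst.prod μ) := klDiv_map_le _ _ measurable_swap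
    _ ≤ klDiv Q (ν.prod μ) := key
    _ = klDiv (P.map Prod.swap) ((μ.prod ν).map Prod.swap) := by rw [Measure.prod_swap]
    _ ≤ klDiv P (μ.prod ν) := klDiv_map_le _ _ measurable_swap

/-- A density in the input variable passes through the channel unchanged. This lets two input laws
share one likelihood ratio of joint law to product law. -/
lemma withDensity_compProd_left {α β : Type*} [MeasurableSpace α] [MeasurableSpace β]
    (μ : Measure α) [SFinite μ] (κ : Kernel α β) [IsSFiniteKernel κ] {g : α → ℝ≥0∞}
    (hg : Measurable g) [SFinite (μ.withDensity g)] :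
    (μ.withDensity g) ⊗ₘ κ = (μ ⊗ₘ κ).withDensity (fun z => g z.1) := by
  ext s hs
  rw [Measure.compProd_apply hs, withDensity_apply _ hs,
    lintegral_withDensity_eq_lintegral_mul _ hg (Kernel.measurable_kernel_prodMk_left hs),
    ← lintegral_indicator hs, Measure.lintegral_compProd]
  · refine lintegral_congr fun a => ?_
    have : (fun b => s.indicator (fun z : α × β => g z.1) (a, b)) =
        fun b => g a * (Prod.mk a ⁻¹' s).indicator 1 b := by
      ext b
      by_cases h : (a, b) ∈ s <;> simp [h]
    rw [this, lintegral_const_mul _ (measurable_one.indicator (measurable_prodMk_left hs)),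
      lintegral_indicator_one (measurable_prodMk_left hs)]
    rfl
  · exact (hg.comp measurable_fst).indicator hs

open InformationTheory in
/-- Mutual information is at least the contribution of one component of a mixture. -/
lemma mul_mutualInfo_le {𝒴 : Type*} [MeasurableSpace 𝒴] (κ : Kernel I 𝒴) [IsMarkovKernel κ]
    (μ₁ μ : Measure I) [IsProbabilityMeasure μ₁] [IsProbabilityMeasure μ] (a : ℝ≥0)
    (ha : a ≠ 0) (h : (a : ℝ≥0∞) • μ₁ ≤ μ) :
    a * mutualInfo κ μ₁ ≤ mutualInfo κ μ := by
  set ν := κ ∘ₘ μ with hν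
  -- The output law of `μ₁` is exchanged for that of the mixture, so that both divergences refer to
  -- the same second marginal.
  have hgold : mutualInfo κ μ₁ ≤ klDiv (μ₁ ⊗ₘ κ) (μ₁.prod ν) := by
    have := klDiv_prod_snd_le (μ₁ ⊗ₘ κ) μ₁ ν
    rwa [Measure.snd_compProd] at this
  refine (mul_le_mul_right hgold _).trans ?_
  rw [mutualInfo, ← hν]
  by_cases hac : μ ⊗ₘ κ ≪ μ.prod ν
  swap
  · rw [klDiv_of_not_ac hac]; exact le_top
  have ha' : (a : ℝ≥0∞) ≠ 0 := by simpa using ha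
  have hμ : μ₁ ≪ μ := by
    intro s hs
    have : ((a : ℝ≥0∞) • μ₁) s ≤ μ s := h s
    rw [hs] at this
    simpa [ha] using this
  set g := μ₁.rnDeriv μ with hgdef
  have hg : Measurable g := Measure.measurable_rnDeriv _ _
  have hμ₁ : μ.withDensity g = μ₁ := Measure.withDensity_rnDeriv_eq _ _ hμ
  have : SFinite (μ.withDensity g) := by rw [hμ₁]; infer_instance
  set f := (μ ⊗ₘ κ).rnDeriv (μ.prod ν) with hfdef
  have hf : Measurable f := Measure.measurable_rnDeriv _ _
  have h1 : μ₁.prod ν = (μ.prod ν).withDensity (fun z => g z.1) := by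
    conv_lhs => rw [← hμ₁]
    rw [prod_withDensity_left hg]
  -- The factor `g` enters the joint law and the product law alike, so the ratio `f` of the mixture
  -- also serves for `μ₁`.
  have h2 : μ₁ ⊗ₘ κ = (μ₁.prod ν).withDensity f := by
    conv_lhs => rw [← hμ₁]
    have hg' : Measurable fun z : I × 𝒴 => g z.1 := hg.comp measurable_fst
    rw [withDensity_compProd_left μ κ hg, ← Measure.withDensity_rnDeriv_eq _ _ hac, ← hfdef, h1,
      ← withDensity_mul _ hf hg', ← withDensity_mul _ hg' hf, mul_comm]
  have hac₁ : μ₁ ⊗ₘ κ ≪ μ₁.prod ν := by rw [h2]; exact withDensity_absolutelyContinuous _ _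
  rw [klDiv_eq_lintegral_klFun_of_ac hac, klDiv_eq_lintegral_klFun_of_ac hac₁]
  have hfe : (μ₁ ⊗ₘ κ).rnDeriv (μ₁.prod ν) =ᵐ[μ₁.prod ν] f := by
    rw [h2]; exact Measure.rnDeriv_withDensity _ hf
  have hle : (a : ℝ≥0∞) • (μ₁.prod ν) ≤ μ.prod ν := by
    rw [← Measure.prod_smul_left]
    intro s
    exact Measure.prod_mono h le_rfl s
  calc a * ∫⁻ x, ENNReal.ofReal (klFun ((μ₁ ⊗ₘ κ).rnDeriv (μ₁.prod ν) x).toReal) ∂(μ₁.prod ν)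
      = a * ∫⁻ x, ENNReal.ofReal (klFun (f x).toReal) ∂(μ₁.prod ν) := by
        congr 1
        refine lintegral_congr_ae ?_
        filter_upwards [hfe] with x hx
        rw [hx]
    _ = ∫⁻ x, ENNReal.ofReal (klFun (f x).toReal) ∂((a : ℝ≥0∞) • μ₁.prod ν) := by
        rw [lintegral_smul_measure, smul_eq_mul]
    -- The integrand built from `klFun` is nonnegative, so a larger measure gives a larger integral;
    -- the integrand `log f` would not allow this.
    _ ≤ _ := lintegral_mono' hle le_rfl

end SIET

end

noncomputable section

namespace SIET

/-! ### Admissible densities and the energy they deliver -/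

lemma PiecewiseContinuous.measurable {p : I → ℝ} (hp : PiecewiseContinuous p) : Measurable p := by
  obtain ⟨F, hF, -⟩ := hp
  refine measurable_of_measurable_union_cover (F : Set I) ((F : Set I)ᶜ)
    F.finite_toSet.measurableSet F.finite_toSet.measurableSet.compl (by simp) ?_ ?_
  · exact measurable_of_countable _
  · exact (continuousOn_iff_continuous_domRestrict.1 hF).measurable

lemma exists_sided_limits_of_continuousOn {p : I → ℝ} {F : Finset I}
    (hp : ContinuousOn p ((F : Set I)ᶜ)) {x : I} (hx : x ∉ F) :
    (∃ l, Tendsto p (𝓝[<] x) (𝓝 l)) ∧ (∃ l, Tendsto p (𝓝[>] x) (𝓝 l)) := by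
  have h : ContinuousAt p x :=
    hp.continuousAt (F.finite_toSet.isClosed.isOpen_compl.mem_nhds (by simpa using hx))
  exact ⟨⟨_, h.tendsto.mono_left inf_le_left⟩, ⟨_, h.tendsto.mono_left inf_le_left⟩⟩

lemma PiecewiseContinuous.mix {p q : I → ℝ} (hp : PiecewiseContinuous p)
    (hq : PiecewiseContinuous q) (a b : ℝ) :
    PiecewiseContinuous (fun x => a * p x + b * q x) := by
  classical
  obtain ⟨F, hF, hF'⟩ := hp
  obtain ⟨G, hG, hG'⟩ := hq
  refine ⟨F ∪ G, ?_, fun x _ => ?_⟩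
  · refine (continuousOn_const.mul (hF.mono ?_)).add (continuousOn_const.mul (hG.mono ?_)) <;>
      · intro x hx
        simp only [Finset.coe_union, Set.mem_compl_iff, Set.mem_union, not_or] at hx ⊢
        tauto
  · have hp : (∃ l, Tendsto p (𝓝[<] x) (𝓝 l)) ∧ (∃ l, Tendsto p (𝓝[>] x) (𝓝 l)) := by
      by_cases h : x ∈ F
      · exact hF' x h
      · exact exists_sided_limits_of_continuousOn hF h
    have hq : (∃ l, Tendsto q (𝓝[<] x) (𝓝 l)) ∧ (∃ l, Tendsto q (𝓝[>] x) (𝓝 l)) := by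
      by_cases h : x ∈ G
      · exact hG' x h
      · exact exists_sided_limits_of_continuousOn hG h
    obtain ⟨⟨l₁, h₁⟩, ⟨l₂, h₂⟩⟩ := hp
    obtain ⟨⟨r₁, k₁⟩, ⟨r₂, k₂⟩⟩ := hq
    exact ⟨⟨_, (h₁.const_mul a).add (k₁.const_mul b)⟩, ⟨_, (h₂.const_mul a).add (k₂.const_mul b)⟩⟩

variable {cmax : ℝ}

lemma integrable_of_mem_admissible {p : I → ℝ} (hp : p ∈ Admissible cmax) :
    Integrable p := by
  refine Integrable.of_bound hp.1.measurable.aestronglyMeasurable cmax (.of_forall fun x => ?_)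
  rw [Real.norm_eq_abs, abs_of_nonneg (hp.2.1 x)]
  exact hp.2.2.1 x

lemma isProbabilityMeasure_inputLaw {p : I → ℝ} (hp : p ∈ Admissible cmax) :
    IsProbabilityMeasure (inputLaw p) := by
  refine ⟨?_⟩
  rw [inputLaw, withDensity_apply _ MeasurableSet.univ, Measure.restrict_univ,
    ← ofReal_integral_eq_lintegral_ofReal (integrable_of_mem_admissible hp) (.of_forall hp.2.1),
    hp.2.2.2, ENNReal.ofReal_one]

/-- Convexity of the admissible class, on which the mixing argument depends. -/
lemma mix_mem_admissible {p q : I → ℝ} (hp : p ∈ Admissible cmax) (hq : q ∈ Admissible cmax)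
    {t : ℝ} (h0 : 0 ≤ t) (h1 : t ≤ 1) :
    (fun x => (1 - t) * p x + t * q x) ∈ Admissible cmax := by
  refine ⟨hp.1.mix hq.1 _ _, fun x => ?_, fun x => ?_, ?_⟩
  · have := hp.2.1 x
    have := hq.2.1 x
    have : 0 ≤ 1 - t := by linarith
    positivity
  · have h2 := mul_le_mul_of_nonneg_left (hp.2.2.1 x) (sub_nonneg.2 h1)
    have h3 := mul_le_mul_of_nonneg_left (hq.2.2.1 x) h0
    linarith
  · rw [integral_add ((integrable_of_mem_admissible hp).const_mul _)
      ((integrable_of_mem_admissible hq).const_mul _), integral_const_mul, integral_const_mul,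
      hp.2.2.2, hq.2.2.2]
    ring

lemma energy_eq_integral_mul {p : I → ℝ} (hp : p ∈ Admissible cmax) (β : I → ℝ) :
    energy β p = ∫ x, p x * β x := by
  rw [energy, inputLaw, integral_withDensity_eq_integral_toReal_smul
    hp.1.measurable.ennreal_ofReal (.of_forall fun x => ENNReal.ofReal_lt_top)]
  refine integral_congr_ae (.of_forall fun x => ?_)
  simp [ENNReal.toReal_ofReal (hp.2.1 x)]

lemma integrable_mul_of_mem_admissible {p β : I → ℝ} (hp : p ∈ Admissible cmax)
    (hβ : Integrable β) : Integrable (fun x => p x * β x) := by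
  refine hβ.bdd_mul (c := cmax) hp.1.measurable.aestronglyMeasurable (.of_forall fun x => ?_)
  rw [Real.norm_eq_abs, abs_of_nonneg (hp.2.1 x)]
  exact hp.2.2.1 x

lemma energy_mix {p q β : I → ℝ} (hp : p ∈ Admissible cmax) (hq : q ∈ Admissible cmax)
    (hβ : Integrable β) {t : ℝ} (h0 : 0 ≤ t) (h1 : t ≤ 1) :
    energy β (fun x => (1 - t) * p x + t * q x) = (1 - t) * energy β p + t * energy β q := by
  rw [energy_eq_integral_mul (mix_mem_admissible hp hq h0 h1), energy_eq_integral_mul hp,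
    energy_eq_integral_mul hq, ← integral_const_mul, ← integral_const_mul, ← integral_add]
  · refine integral_congr_ae (.of_forall fun x => ?_)
    simp only
    ring
  · exact (integrable_mul_of_mem_admissible hp hβ).const_mul _
  · exact (integrable_mul_of_mem_admissible hq hβ).const_mul _

lemma energy_congr_ae {p β β' : I → ℝ} (h : β =ᵐ[volume] β') : energy β p = energy β' p :=
  integral_congr_ae ((withDensity_absolutelyContinuous _ _).ae_le h)

/-- The bound `cmax` on the densities makes the estimate uniform in `p`, so L¹ convergence of the
reconstruction suffices. -/
lemma abs_energy_sub_le {p β β' : I → ℝ} (hp : p ∈ Admissible cmax) (hβ : Integrable β)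
    (hβ' : Integrable β') : |energy β p - energy β' p| ≤ cmax * ∫ x, |β x - β' x| := by
  rw [energy_eq_integral_mul hp, energy_eq_integral_mul hp,
    ← integral_sub (integrable_mul_of_mem_admissible hp hβ)
      (integrable_mul_of_mem_admissible hp hβ'), ← integral_const_mul]
  refine abs_integral_le_integral_abs.trans (integral_mono_of_nonneg
    (.of_forall fun x => abs_nonneg _) ((hβ.sub hβ').abs.const_mul _) (.of_forall fun x => ?_))
  simp only
  rw [← mul_sub, abs_mul, abs_of_nonneg (hp.2.1 x)]
  exact mul_le_mul_of_nonneg_right (hp.2.2.1 x) (abs_nonneg _)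

/-- Dropping the nonnegative contribution of `q` gives the domination that `mul_mutualInfo_le`
requires. -/
lemma inputLaw_smul_le {p q : I → ℝ} (hp : p ∈ Admissible cmax) (hq : q ∈ Admissible cmax)
    {t : ℝ} (h0 : 0 ≤ t) (h1 : t ≤ 1) :
    ((1 - t).toNNReal : ℝ≥0∞) • inputLaw p ≤ inputLaw (fun x => (1 - t) * p x + t * q x) := by
  rw [inputLaw, inputLaw, ← withDensity_smul _ hp.1.measurable.ennreal_ofReal]
  refine withDensity_mono (.of_forall fun x => ?_)
  simp only [Pi.smul_apply, smul_eq_mul]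
  rw [ENNReal.ofNNReal_toNNReal, ← ENNReal.ofReal_mul (sub_nonneg.2 h1)]
  exact ENNReal.ofReal_le_ofReal (le_add_of_nonneg_right (mul_nonneg h0 (hq.2.1 x)))

/-! ### The capacity-energy function -/

variable {𝒴 : Type*} [MeasurableSpace 𝒴] (κ : Kernel I 𝒴)

lemma capacity_le_maxCapacity (cmax : ℝ) (β : I → ℝ) (B : ℝ) :
    capacity κ cmax β B ≤ maxCapacity κ cmax :=
  biSup_mono fun _ h => h.1

lemma mutualInfo_le_capacity {p β : I → ℝ} {B : ℝ} (hp : p ∈ Admissible cmax)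
    (hB : B ≤ energy β p) : mutualInfo κ (inputLaw p) ≤ capacity κ cmax β B :=
  le_iSup₂_of_le p ⟨hp, hB⟩ le_rfl

variable [IsMarkovKernel κ]

/-- Mixing every input that delivers energy `B` for `β₁` with one and the same input `q` costs only
a factor `1 - t`. -/
lemma mul_capacity_le {β₁ β₂ q : I → ℝ} {B t : ℝ} (hq : q ∈ Admissible cmax) (h0 : 0 ≤ t)
    (h1 : t < 1) (h : ∀ p ∈ Admissible cmax, B ≤ energy β₁ p →
      B ≤ energy β₂ (fun x => (1 - t) * p x + t * q x)) :
    (1 - t).toNNReal * capacity κ cmax β₁ B ≤ capacity κ cmax β₂ B := by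
  rw [capacity]
  simp only [ENNReal.mul_iSup]
  refine iSup₂_le fun p hp => ?_
  have := isProbabilityMeasure_inputLaw hp.1
  have hm := mix_mem_admissible hp.1 hq h0 h1.le
  have := isProbabilityMeasure_inputLaw hm
  refine (mul_mutualInfo_le κ _ _ _ ?_ (inputLaw_smul_le hp.1 hq h0 h1.le)).trans
    (mutualInfo_le_capacity κ hm (h p hp.1 hp.2))
  simpa using h1

lemma toReal_sub_le_of_mul_le {C₁ C₂ M : ℝ≥0∞} (hM : M ≠ ∞) (h₁ : C₁ ≤ M) (h₂ : C₂ ≤ M) {t : ℝ}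
    (h0 : 0 ≤ t) (h1 : t < 1) (h : (1 - t).toNNReal * C₁ ≤ C₂) :
    C₁.toReal - C₂.toReal ≤ t * M.toReal := by
  have h3 := ENNReal.toReal_mono (ne_top_of_le_ne_top hM h₂) h
  rw [ENNReal.toReal_mul, ENNReal.coe_toReal, Real.coe_toNNReal _ (by linarith)] at h3
  have h4 := mul_le_mul_of_nonneg_left (ENNReal.toReal_mono hM h₁) h0
  linarith

/-- The input `q` exceeds the energy `B` by a margin; giving it weight `t` gains `t` times that
margin, which by `ht` covers the discrepancy `ε`. The margin is measured for `β` in both directions.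
-/
lemma abs_capacity_sub_le (hC : maxCapacity κ cmax ≠ ∞) {β β' q : I → ℝ} (hβ : Integrable β)
    {B t ε : ℝ} (hq : q ∈ Admissible cmax) (h0 : 0 ≤ t) (h1 : t < 1)
    (hε : ∀ p ∈ Admissible cmax, |energy β p - energy β' p| ≤ ε)
    (ht : ε ≤ t * (energy β q - B)) :
    |(capacity κ cmax β B).toReal - (capacity κ cmax β' B).toReal| ≤
      t * (maxCapacity κ cmax).toReal := by
  rw [abs_sub_le_iff]
  constructor
  -- An input feasible for `β` acquires a surplus `ε` by mixing and stays feasible after passing to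
  -- `β'`.
  · refine toReal_sub_le_of_mul_le hC (capacity_le_maxCapacity κ _ _ _)
      (capacity_le_maxCapacity κ _ _ _) h0 h1 (mul_capacity_le κ hq h0 h1 fun p hp hB => ?_)
    have h2 := hε _ (mix_mem_admissible hp hq h0 h1.le)
    rw [energy_mix hp hq hβ h0 h1.le] at h2
    have h3 := (abs_le.1 h2).2
    have h4 := mul_le_mul_of_nonneg_left hB (sub_nonneg.2 h1.le)
    linarith
  -- An input feasible for `β'` falls short by at most `ε` for `β`, and mixing restores the deficit.
  · refine toReal_sub_le_of_mul_le hC (capacity_le_maxCapacity κ _ _ _)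
      (capacity_le_maxCapacity κ _ _ _) h0 h1 (mul_capacity_le κ hq h0 h1 fun p hp hB => ?_)
    have h2 := (abs_le.1 (hε p hp)).1
    rw [energy_mix hp hq hβ h0 h1.le]
    have h5 : 0 ≤ ε := (abs_nonneg _).trans (hε p hp)
    have h4 := mul_le_mul_of_nonneg_left (show B - ε ≤ energy β p by linarith)
      (sub_nonneg.2 h1.le)
    have := mul_nonneg h0 h5
    linarith

lemma exists_energy_gt {β : I → ℝ} {B : ℝ} (h0 : 0 ≤ B) (hB : B < maxEnergy cmax β) :
    ∃ q ∈ Admissible cmax, B < energy β q := by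
  have hne : (energy β '' Admissible cmax).Nonempty := by
    -- An empty admissible class would give `maxEnergy` the default value 0; `0 ≤ B` excludes this.
    by_contra h
    rw [Set.not_nonempty_iff_eq_empty] at h
    rw [maxEnergy, h, Real.sSup_empty] at hB
    linarith
  obtain ⟨_, ⟨q, hq, rfl⟩, h⟩ := exists_lt_of_lt_csSup hne hB
  exact ⟨q, hq, h⟩

/-! ### Functions of bounded variation -/

lemma BV.boundedVariationOn {K : ℝ≥0} {β : I → ℝ} (hβ : β ∈ BV K) :
    BoundedVariationOn β Set.univ :=
  ne_top_of_le_ne_top ENNReal.coe_ne_top hβ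

lemma BV.measurable {K : ℝ≥0} {β : I → ℝ} (hβ : β ∈ BV K) : Measurable β := by
  obtain ⟨f, g, hf, hg, rfl⟩ :=
    (BV.boundedVariationOn hβ).locallyBoundedVariationOn.exists_monotoneOn_sub_monotoneOn
  exact (monotoneOn_univ.1 hf).measurable.sub (monotoneOn_univ.1 hg).measurable

lemma BV.abs_sub_le {K : ℝ≥0} {β : I → ℝ} (hβ : β ∈ BV K) (x y : I) : |β x - β y| ≤ K := by
  have h := (eVariationOn.edist_le β (Set.mem_univ x) (Set.mem_univ y)).trans hβ
  rw [edist_dist] at h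
  rw [← Real.dist_eq]
  simpa using ENNReal.ofReal_le_iff_le_toReal ENNReal.coe_ne_top |>.1 h

lemma BV.memLp {K : ℝ≥0} {β : I → ℝ} (hβ : β ∈ BV K) (p : ℝ≥0∞) : MemLp β p := by
  refine MemLp.of_bound (BV.measurable hβ).aestronglyMeasurable (|β 0| + K)
    (.of_forall fun x => ?_)
  have := BV.abs_sub_le hβ x 0
  rw [Real.norm_eq_abs]
  have := abs_sub_abs_le_abs_sub (β x) (β 0)
  linarith

end SIET

end

noncomputable section

namespace SIET

/-! ### Gaussian noise is absolutely continuous -/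

lemma absolutelyContinuous_pi_fin {n : ℕ} (μ ν : Fin n → Measure ℝ) [∀ i, SigmaFinite (μ i)]
    [∀ i, SigmaFinite (ν i)] (h : ∀ i, μ i ≪ ν i) : Measure.pi μ ≪ Measure.pi ν := by
  induction n with
  | zero =>
    rw [Measure.pi_of_empty μ, Measure.pi_of_empty ν]
  | succ n ih =>
    have h1 := (measurePreserving_piFinSuccAbove μ 0).symm.map_eq
    have h2 := (measurePreserving_piFinSuccAbove ν 0).symm.map_eq
    rw [← h1, ← h2]
    exact ((h 0).prod (ih _ _ fun i => h _)).map (MeasurableEquiv.measurable _)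

instance isProbabilityMeasure_noise (sd : ℝ≥0) (m : ℕ) : IsProbabilityMeasure (noise sd m) := by
  unfold noise; infer_instance

/-- Positive variance excludes point masses. Lebesgue null measurability of convex sets thereby
transfers to the law of the noise. -/
lemma noise_absolutelyContinuous {sd : ℝ≥0} (hsd : 0 < sd) (m : ℕ) : noise sd m ≪ volume := by
  rw [noise, volume_pi]
  exact absolutelyContinuous_pi_fin _ _ fun i =>
    gaussianReal_absolutelyContinuous _ (pow_ne_zero _ hsd.ne')

/-! ### Soft thresholding -/

lemma soft_of_lt {t y : ℝ} (ht : 0 ≤ t) (h : t < y) : soft t y = y - t := by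
  have hy : 0 < y := ht.trans_lt h
  rw [soft, Real.sign_of_pos hy, abs_of_pos hy, max_eq_left (by linarith), one_mul]

lemma soft_of_lt_neg {t y : ℝ} (ht : 0 ≤ t) (h : y < -t) : soft t y = y + t := by
  have hy : y < 0 := by linarith
  rw [soft, Real.sign_of_neg hy, abs_of_neg hy, max_eq_left (by linarith)]
  ring

lemma soft_of_abs_le {t y : ℝ} (h : |y| ≤ t) : soft t y = 0 := by
  rw [soft, max_eq_right (by linarith), mul_zero]

/-- The three intervals on which soft thresholding at level `t` is affine. -/
def softPiece (t : ℝ) : Fin 3 → Set ℝ := ![Set.Iio (-t), Set.Icc (-t) t, Set.Ioi t]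

lemma convex_softPiece (t : ℝ) (i : Fin 3) : Convex ℝ (softPiece t i) := by
  fin_cases i
  · exact convex_Iio _
  · exact convex_Icc _ _
  · exact convex_Ioi _

lemma exists_mem_softPiece (t y : ℝ) : ∃ i, y ∈ softPiece t i := by
  rcases lt_or_ge y (-t) with h | h
  · exact ⟨0, h⟩
  · rcases lt_or_ge t y with h' | h'
    · exact ⟨2, h'⟩
    · exact ⟨1, h, h'⟩

lemma exists_soft_eq_affine {t : ℝ} (ht : 0 ≤ t) (i : Fin 3) :
    ∃ a b : ℝ, ∀ y ∈ softPiece t i, soft t y = a * y + b := by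
  fin_cases i
  · exact ⟨1, t, fun y hy => by rw [soft_of_lt_neg ht hy, one_mul]⟩
  · exact ⟨0, 0, fun y hy => by rw [soft_of_abs_le (abs_le.2 hy)]; ring⟩
  · exact ⟨1, -t, fun y hy => by rw [soft_of_lt ht hy]; ring⟩

/-- On each sign pattern of the affine functions `u e + c e` the set below is convex. -/
lemma nullMeasurableSet_forall_sum_soft_lt {ι : Type*} [Fintype ι] {m : ℕ}
    (u : ι → (Fin m → ℝ) →ₗ[ℝ] ℝ) (c : ι → ℝ) {t : ℝ} (ht : 0 ≤ t) (P : Set (ι → ℝ)) (B : ℝ) :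
    NullMeasurableSet {z | ∀ v ∈ P, ∑ e, soft t (u e z + c e) * v e < B} := by
  choose a b hab using fun i => exists_soft_eq_affine ht i
  have h : {z | ∀ v ∈ P, ∑ e, soft t (u e z + c e) * v e < B} =
      ⋃ s : ι → Fin 3,
        (⋂ e, ((u e).toAffineMap + AffineMap.const ℝ (Fin m → ℝ) (c e)) ⁻¹' softPiece t (s e)) ∩
        ⋂ v ∈ P, {z | ∑ e, a (s e) * v e * u e z < B - ∑ e, (a (s e) * c e + b (s e)) * v e} := by
    ext z
    simp only [Set.mem_ofPred_eq, Set.mem_iUnion, Set.mem_inter_iff, Set.mem_iInter,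
      Set.mem_preimage]
    have key : ∀ (s : ι → Fin 3), (∀ e, u e z + c e ∈ softPiece t (s e)) → ∀ v : ι → ℝ,
        (∑ e, soft t (u e z + c e) * v e < B ↔
          ∑ e, a (s e) * v e * u e z < B - ∑ e, (a (s e) * c e + b (s e)) * v e) := by
      intro s hs v
      rw [lt_sub_iff_add_lt, ← Finset.sum_add_distrib]
      simp_rw [fun e => hab (s e) _ (hs e)]
      rw [Finset.sum_congr rfl fun e _ => ?_]
      ring
    constructor
    · intro hz
      choose s hs using fun e => exists_mem_softPiece t (u e z + c e)
      exact ⟨s, hs, fun v hv => (key s hs v).1 (hz v hv)⟩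
    · rintro ⟨s, hs, hz⟩ v hv
      exact (key s hs v).2 (hz v hv)
  rw [h]
  -- The union is over finitely many patterns. The intersection over `P` may be uncountable, but any
  -- intersection of half-spaces is convex, and convex sets are null measurable.
  refine .iUnion fun s => Convex.nullMeasurableSet volume (Convex.inter
    (convex_iInter fun e => (convex_softPiece t (s e)).affine_preimage _)
    (convex_iInter₂ fun v _ => convex_halfSpace_lt ?_ _))
  exact ⟨fun x y => by simp [mul_add, Finset.sum_add_distrib],
    fun r x => by simp [Finset.mul_sum, mul_left_comm]⟩

lemma nullMeasurable_of_Iic {α : Type*} [MeasurableSpace α] {μ : Measure α} {f : α → ℝ≥0∞}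
    (h : ∀ r, NullMeasurableSet (f ⁻¹' Set.Iic r) μ) : NullMeasurable f μ :=
  measurable_of_Iic (δ := NullMeasurableSpace α μ) h

/-- Suprema of `f p` over the `p` in a half-space that depends on soft-thresholded coefficients are
measurable up to null sets. -/
lemma aemeasurable_biSup_soft {ι α : Type*} [Fintype ι] {m : ℕ}
    (u : ι → (Fin m → ℝ) →ₗ[ℝ] ℝ) (c : ι → ℝ) {t : ℝ} (ht : 0 ≤ t) (S : Set α) (f : α → ℝ≥0∞)
    (v : α → ι → ℝ) (B : ℝ) {μ : Measure (Fin m → ℝ)} (hμ : μ ≪ volume) :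
    AEMeasurable (fun z => ⨆ p ∈ {p | p ∈ S ∧ B ≤ ∑ e, soft t (u e z + c e) * v p e}, f p) μ := by
  refine MeasureTheory.NullMeasurable.aemeasurable (nullMeasurable_of_Iic fun r => ?_)
  -- The supremum is at most `r` exactly when every `p` of value above `r` violates the constraint;
  -- this removes the `z`-dependent index set.
  have : (fun z => ⨆ p ∈ {p | p ∈ S ∧ B ≤ ∑ e, soft t (u e z + c e) * v p e}, f p) ⁻¹' Set.Iic r =
      {z | ∀ w ∈ v '' {p | p ∈ S ∧ r < f p}, ∑ e, soft t (u e z + c e) * w e < B} := by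
    ext z
    simp only [Set.mem_ofPred_eq, Set.mem_preimage, Set.mem_Iic, iSup_le_iff, Set.forall_mem_image]
    refine ⟨fun h p hp => ?_, fun h p hp => ?_⟩
    · by_contra hB
      exact absurd (h p ⟨hp.1, not_lt.1 hB⟩) (not_le.2 hp.2)
    · by_contra hr
      exact absurd (h ⟨hp.1, not_le.1 hr⟩) (not_lt.2 hp.2)
  rw [this]
  exact (nullMeasurableSet_forall_sum_soft_lt u c ht _ B).mono_ac hμ

end SIET

end

noncomputable section

namespace SIET

/-! ### Periodization of compactly supported functions -/

/-- The `1`-periodization of a function on the line. -/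
def periodize (g : ℝ → ℝ) (x : ℝ) : ℝ := ∑' l : ℤ, g (x + l)

/-- `g` vanishes outside `[-M, M]`. -/
def VanishesBeyond (M : ℕ) (g : ℝ → ℝ) : Prop := ∀ x, (M : ℝ) < |x| → g x = 0

lemma VanishesBeyond.mono {M N : ℕ} {g : ℝ → ℝ} (h : VanishesBeyond M g) (hMN : M ≤ N) :
    VanishesBeyond N g := fun x hx => h x (lt_of_le_of_lt (by exact_mod_cast hMN) hx)

lemma exists_vanishesBeyond {g : ℝ → ℝ} (hg : HasCompactSupport g) :
    ∃ M, VanishesBeyond M g := by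
  obtain ⟨r, hr⟩ := hg.isBounded.subset_closedBall 0
  obtain ⟨M, hM⟩ := exists_nat_gt r
  refine ⟨M, fun x hx => ?_⟩
  by_contra h
  have := hr (subset_tsupport g h)
  rw [mem_closedBall_zero_iff, Real.norm_eq_abs] at this
  linarith

lemma periodize_add_int (g : ℝ → ℝ) (x : ℝ) (n : ℤ) : periodize g (x + n) = periodize g x := by
  rw [periodize, periodize, ← (Equiv.addLeft n).tsum_eq fun l : ℤ => g (x + l)]
  refine tsum_congr fun l => ?_
  simp [add_assoc]

lemma VanishesBeyond.periodize_eq_sum {M R : ℕ} {g : ℝ → ℝ} (hg : VanishesBeyond M g) {x : ℝ}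
    (hx : |x| ≤ R) :
    periodize g x = ∑ l ∈ Finset.Icc (-((M + R : ℕ) : ℤ)) (M + R : ℕ), g (x + l) := by
  refine tsum_eq_sum fun l hl => hg _ ?_
  rw [Finset.mem_Icc, ← abs_le, not_le] at hl
  have h1 : ((M + R : ℕ) : ℝ) < |(l : ℝ)| := by exact_mod_cast hl
  have h2 := abs_sub_abs_le_abs_sub (l : ℝ) (-x)
  rw [abs_neg, sub_neg_eq_add, add_comm (l : ℝ)] at h2
  push_cast at h1
  linarith

lemma abs_coe_unitInterval_le (x : I) : |(x : ℝ)| ≤ (1 : ℕ) := by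
  rw [abs_of_nonneg x.2.1]
  simpa using x.2.2

lemma measurePreserving_coe_unitInterval :
    MeasurePreserving ((↑) : I → ℝ) volume (volume.restrict (Set.Icc 0 1)) :=
  measurePreserving_subtype_coe measurableSet_Icc

lemma integral_unitInterval (f : ℝ → ℝ) : ∫ x : I, f x = ∫ x in (0 : ℝ)..1, f x := by
  rw [intervalIntegral.integral_of_le zero_le_one, ← integral_Icc_eq_integral_Ioc]
  exact integral_subtype measurableSet_Icc f

lemma memLp_translate {g : ℝ → ℝ} (hg : MemLp g 2) (a : ℝ) : MemLp (fun x => g (x + a)) 2 :=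
  hg.comp_measurePreserving (measurePreserving_add_right volume a)

lemma memLp_coe_unitInterval {g : ℝ → ℝ} (hg : MemLp g 2) : MemLp (fun x : I => g x) 2 :=
  (hg.restrict _).comp_measurePreserving measurePreserving_coe_unitInterval

lemma VanishesBeyond.memLp_periodize {M : ℕ} {g : ℝ → ℝ} (hg : VanishesBeyond M g)
    (hg2 : MemLp g 2) : MemLp (fun x : I => periodize g x) 2 := by
  have : (fun x : I => periodize g x) =
      fun x : I => ∑ l ∈ Finset.Icc (-((M + 1 : ℕ) : ℤ)) (M + 1 : ℕ), g (x + l) :=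
    funext fun x => hg.periodize_eq_sum (abs_coe_unitInterval_le x)
  rw [this]
  exact memLp_finsetSum _ fun l _ => memLp_coe_unitInterval (memLp_translate hg2 l)

/-- The unit intervals tile the line, and only finitely many of them meet the support of `g`. -/
lemma VanishesBeyond.integral_periodize {M : ℕ} {g : ℝ → ℝ} (hg : VanishesBeyond M g)
    (hgi : Integrable g) : ∫ x : I, periodize g x = ∫ x, g x := by
  have h0 : ∀ x ∈ Set.uIcc (0 : ℝ) 1,
      periodize g x = ∑ l ∈ Finset.Icc (-((M + 1 : ℕ) : ℤ)) (M + 1 : ℕ), g (x + l) := by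
    intro x hx
    rw [Set.uIcc_of_le zero_le_one] at hx
    exact hg.periodize_eq_sum (abs_coe_unitInterval_le ⟨x, hx⟩)
  rw [integral_unitInterval, intervalIntegral.integral_congr h0,
    intervalIntegral.integral_finsetSum
      fun l _ => (hgi.comp_add_right _).intervalIntegrable]
  refine HasSum.unique ?_ hgi.hasSum_intervalIntegral_comp_add_int
  refine hasSum_sum_of_ne_finset_zero fun l hl => ?_
  rw [intervalIntegral.integral_congr (g := fun _ => 0)]
  · simp
  intro x hx
  rw [Set.uIcc_of_le zero_le_one] at hx
  refine hg _ ?_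
  rw [Finset.mem_Icc, ← abs_le, not_le] at hl
  have h1 : ((M + 1 : ℕ) : ℝ) < |(l : ℝ)| := by exact_mod_cast hl
  have h2 := abs_sub_abs_le_abs_sub (l : ℝ) (-x)
  rw [abs_neg, sub_neg_eq_add, add_comm (l : ℝ)] at h2
  have h3 := abs_coe_unitInterval_le ⟨x, hx⟩
  push_cast at h1 h3
  linarith

lemma VanishesBeyond.mul_periodize {M : ℕ} {g h : ℝ → ℝ} (hg : VanishesBeyond M g)
    (hh : VanishesBeyond M h) (x : ℝ) :
    g x * periodize h x = ∑ n ∈ Finset.Icc (-((M + M : ℕ) : ℤ)) (M + M : ℕ), g x * h (x + n) := by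
  by_cases hx : |x| ≤ M
  · rw [hh.periodize_eq_sum hx, Finset.mul_sum]
  · simp [hg x (not_le.1 hx)]

/-- Inner products of periodizations. -/
lemma VanishesBeyond.integral_periodize_mul_periodize {M : ℕ} {g h : ℝ → ℝ}
    (hg : VanishesBeyond M g) (hh : VanishesBeyond M h) (hg2 : MemLp g 2) (hh2 : MemLp h 2) :
    ∫ x : I, periodize g x * periodize h x =
      ∑ n ∈ Finset.Icc (-((M + M : ℕ) : ℤ)) (M + M : ℕ), ∫ x, g x * h (x + n) := by
  have hint : ∀ n : ℤ, Integrable fun x => g x * h (x + n) := fun n =>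
    hg2.integrable_mul (memLp_translate hh2 n)
  -- Since `periodize h` is 1-periodic it can be moved inside the sum that periodizes `g`; the
  -- integral over the period then unfolds to the line.
  have h1 : ∀ x : ℝ, periodize g x * periodize h x = periodize (fun y => g y * periodize h y) x := by
    intro x
    rw [periodize, ← tsum_mul_right]
    exact tsum_congr fun l => by simp only [periodize_add_int]
  have h2 : (fun y => g y * periodize h y) = fun y =>
      ∑ n ∈ Finset.Icc (-((M + M : ℕ) : ℤ)) (M + M : ℕ), g y * h (y + n) :=
    funext (hg.mul_periodize hh)
  have h3 : VanishesBeyond M fun y => g y * periodize h y := fun x hx => by simp [hg x hx]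
  simp_rw [h1]
  rw [h3.integral_periodize (by rw [h2]; exact integrable_finsetSum _ fun n _ => hint n), h2,
    integral_finsetSum _ fun n _ => hint n]

/-- After unfolding, the integers in [-2M, 2M] give 4M+1 shifted inner products, each at most the
squared norm of `g`. Periodization is therefore L²-bounded on functions with a common support, which
carries approximation from the line to [0,1]. -/
lemma VanishesBeyond.integral_periodize_sq_le {M : ℕ} {g : ℝ → ℝ}
    (hg : VanishesBeyond M g) (hg2 : MemLp g 2) :
    ∫ x : I, periodize g x ^ 2 ≤ (4 * M + 1) * ∫ x, g x ^ 2 := by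
  have hsq : Integrable fun x => g x ^ 2 := hg2.integrable_sq
  simp_rw [sq (periodize g _)]
  rw [hg.integral_periodize_mul_periodize hg hg2 hg2]
  calc _ ≤ ∑ n ∈ Finset.Icc (-((M + M : ℕ) : ℤ)) (M + M : ℕ), ∫ x, g x ^ 2 := by
        refine Finset.sum_le_sum fun n _ => ?_
        calc ∫ x, g x * g (x + n) ≤ ∫ x, (g x ^ 2 + g (x + n) ^ 2) / 2 := by
              refine integral_mono (hg2.integrable_mul (memLp_translate hg2 n))
                ((hsq.add (hsq.comp_add_right _)).div_const 2) fun x => ?_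
              simp only
              nlinarith [sq_nonneg (g x - g (x + n))]
          _ = ∫ x, g x ^ 2 := by
              rw [integral_div, integral_add hsq (hsq.comp_add_right _),
                integral_add_right_eq_self (fun x => g x ^ 2)]
              ring
    _ = _ := by
        rw [Finset.sum_const, Int.card_Icc, nsmul_eq_mul]
        congr 1
        rw [show ((M + M : ℕ) : ℤ) + 1 - -((M + M : ℕ) : ℤ) = ((4 * M + 1 : ℕ) : ℤ) by
          push_cast; ring, Int.toNat_natCast]
        push_cast
        ring

lemma ae_periodize_eq {g h : ℝ → ℝ} (hgh : g =ᵐ[volume] h) :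
    (fun x : I => periodize g x) =ᵐ[volume] fun x : I => periodize h x := by
  have h1 : ∀ l : ℤ, ∀ᵐ x : ℝ, g (x + l) = h (x + l) := fun l =>
    (measurePreserving_add_right volume (l : ℝ)).quasiMeasurePreserving.ae_eq_comp hgh
  have h2 : ∀ᵐ x ∂(volume.restrict (Set.Icc (0 : ℝ) 1)), ∀ l : ℤ, g (x + l) = h (x + l) :=
    ae_restrict_of_ae (ae_all_iff.2 h1)
  filter_upwards [measurePreserving_coe_unitInterval.quasiMeasurePreserving.ae h2] with x hx
  exact tsum_congr hx

lemma VanishesBeyond.add {M : ℕ} {g h : ℝ → ℝ} (hg : VanishesBeyond M g)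
    (hh : VanishesBeyond M h) : VanishesBeyond M (fun x => g x + h x) := fun x hx => by
  simp [hg x hx, hh x hx]

lemma VanishesBeyond.sum {ι : Type*} {M : ℕ} (s : Finset ι) (c : ι → ℝ) {g : ι → ℝ → ℝ}
    (hg : ∀ i ∈ s, VanishesBeyond M (g i)) : VanishesBeyond M (fun x => ∑ i ∈ s, c i * g i x) :=
  fun x hx => Finset.sum_eq_zero fun i hi => by rw [hg i hi x hx, mul_zero]

lemma VanishesBeyond.summable {M : ℕ} {g : ℝ → ℝ} (hg : VanishesBeyond M g) (x : ℝ) :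
    Summable fun l : ℤ => g (x + l) := by
  obtain ⟨R, hR⟩ := exists_nat_ge |x|
  refine summable_of_hasFiniteSupport (Set.Finite.subset
    (Finset.finite_toSet (Finset.Icc (-((M + R : ℕ) : ℤ)) (M + R : ℕ))) fun l hl => ?_)
  by_contra h
  refine hl (hg _ ?_)
  rw [Finset.mem_coe, Finset.mem_Icc, ← abs_le, not_le] at h
  have h1 : ((M + R : ℕ) : ℝ) < |(l : ℝ)| := by exact_mod_cast h
  have h2 := abs_sub_abs_le_abs_sub (l : ℝ) (-x)
  rw [abs_neg, sub_neg_eq_add, add_comm (l : ℝ)] at h2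
  push_cast at h1
  linarith

lemma VanishesBeyond.periodize_add {M : ℕ} {g h : ℝ → ℝ} (hg : VanishesBeyond M g)
    (hh : VanishesBeyond M h) (x : ℝ) :
    periodize (fun x => g x + h x) x = periodize g x + periodize h x :=
  (hg.summable x).tsum_add (hh.summable x)

lemma periodize_sum {ι : Type*} (s : Finset ι) (c : ι → ℝ) {g : ι → ℝ → ℝ}
    (hg : ∀ i, ∃ M, VanishesBeyond M (g i)) (x : ℝ) :
    periodize (fun x => ∑ i ∈ s, c i * g i x) x = ∑ i ∈ s, c i * periodize (g i) x := by
  rw [periodize, Summable.tsum_finsetSum fun i _ => ?_]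
  · simp_rw [tsum_mul_left]
    rfl
  · obtain ⟨M, hM⟩ := hg i
    exact (hM.summable x).mul_left _

end SIET

end

noncomputable section

namespace SIET

/-! ### Dilated translates -/

lemma dilate_add_int (f : ℝ → ℝ) (j : ℕ) (k n : ℤ) (x : ℝ) :
    dilate f j k (x + n) = dilate f j (k - 2 ^ j * n) x := by
  simp only [dilate, zpow_natCast]
  congr 2
  push_cast
  ring

lemma memLp_dilate {f : ℝ → ℝ} (hf : MemLp f 2) (j k : ℤ) : MemLp (dilate f j k) 2 := by
  have hc : (2 : ℝ) ^ j ≠ 0 := (zpow_pos two_pos _).ne'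
  have h1 : MemLp (fun x => f (x - k)) 2 := by
    simpa [sub_eq_add_neg] using memLp_translate hf (-k : ℝ)
  refine MemLp.const_mul (f := fun x => f ((2 : ℝ) ^ j * x - k)) ?_ _
  have h2 := h1.smul_measure (c := ENNReal.ofReal |((2 : ℝ) ^ j)⁻¹|) ENNReal.ofReal_ne_top
  rw [← Real.map_volume_mul_left hc] at h2
  exact (memLp_map_measure_iff h2.1 (measurable_const_mul _).aemeasurable).1 h2

lemma VanishesBeyond.dilate_eq_zero {M : ℕ} {f : ℝ → ℝ} (hf : VanishesBeyond M f) {j k : ℤ}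
    {x : ℝ} (h : (M : ℝ) < |2 ^ j * x - k|) : dilate f j k x = 0 := by
  rw [dilate, hf _ h, mul_zero]

lemma exists_vanishesBeyond_dilate {f : ℝ → ℝ} (hf : ∃ M, VanishesBeyond M f) (j k : ℤ) :
    ∃ M, VanishesBeyond M (dilate f j k) := by
  obtain ⟨M, hM⟩ := hf
  obtain ⟨N, hN⟩ := exists_nat_ge ((M + |(k : ℝ)|) / 2 ^ j)
  refine ⟨N, fun x hx => hM.dilate_eq_zero ?_⟩
  have hc : (0 : ℝ) < 2 ^ j := zpow_pos two_pos _
  have h1 := (div_lt_iff₀ hc).1 (hN.trans_lt hx)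
  have h2 := abs_sub_abs_le_abs_sub ((2 : ℝ) ^ j * x) k
  rw [abs_mul, abs_of_pos hc] at h2
  linarith

/-- If `h` vanishes outside a bounded set, only finitely many translates of one scale meet it. -/
lemma VanishesBeyond.dilate_mul_eq_zero {M R : ℕ} {f h : ℝ → ℝ} (hf : VanishesBeyond M f)
    (hh : VanishesBeyond R h) {j k : ℤ} (hk : M + 2 ^ j * (R : ℝ) < |(k : ℝ)|) (x : ℝ) :
    h x * dilate f j k x = 0 := by
  by_cases hx : (R : ℝ) < |x|
  · rw [hh x hx, zero_mul]
  rw [hf.dilate_eq_zero, mul_zero]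
  have hc : (0 : ℝ) < 2 ^ j := zpow_pos two_pos _
  have h1 := abs_sub_abs_le_abs_sub (k : ℝ) ((2 : ℝ) ^ j * x)
  rw [abs_mul, abs_of_pos hc, abs_sub_comm] at h1
  have := mul_le_mul_of_nonneg_left (not_lt.1 hx) hc.le
  linarith

lemma VanishesBeyond.exists_finset_dilate {M R : ℕ} {f h : ℝ → ℝ} (hf : VanishesBeyond M f)
    (hh : VanishesBeyond R h) (j : ℤ) :
    ∃ T : Finset ℤ, ∀ k ∉ T, ∀ x, h x * dilate f j k x = 0 := by
  obtain ⟨N, hN⟩ := exists_nat_ge (M + 2 ^ j * (R : ℝ))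
  refine ⟨Finset.Icc (-(N : ℤ)) N, fun k hk => hf.dilate_mul_eq_zero hh (hN.trans_lt ?_)⟩
  rw [Finset.mem_Icc, ← abs_le, not_le] at hk
  exact_mod_cast hk

/-- The dilated translates as elements of `L²(ℝ)`. -/
def dilateLp {f : ℝ → ℝ} (hf : MemLp f 2) (j k : ℤ) : Lp ℝ 2 (volume : Measure ℝ) :=
  (memLp_dilate hf j k).toLp

lemma inner_toLp {α : Type*} [MeasurableSpace α] {μ : Measure α} {f g : α → ℝ} (hf : MemLp f 2 μ)
    (hg : MemLp g 2 μ) : inner ℝ hf.toLp hg.toLp = ∫ x, f x * g x ∂μ := by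
  rw [L2.inner_def]
  refine integral_congr_ae ?_
  filter_upwards [hf.coeFn_toLp, hg.coeFn_toLp] with x h1 h2
  rw [h1, h2]
  simp [mul_comm]

lemma inner_dilateLp {f g : ℝ → ℝ} (hf : MemLp f 2) (hg : MemLp g 2) (j k j' k' : ℤ) :
    inner ℝ (dilateLp hf j k) (dilateLp hg j' k') = ∫ x, dilate f j k x * dilate g j' k' x :=
  inner_toLp _ _

lemma scaleSpace_eq {f : ℝ → ℝ} (hf : MemLp f 2) (j : ℤ) :
    scaleSpace f j = (Submodule.span ℝ (Set.range (dilateLp hf j))).topologicalClosure := by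
  rw [scaleSpace]
  congr 2
  ext g
  simp only [Set.mem_ofPred_eq, Set.mem_range]
  refine exists_congr fun k => ⟨fun h => ?_, fun h => ?_⟩
  · exact Lp.ext ((MemLp.coeFn_toLp _).trans h.symm)
  · rw [← h]; exact MemLp.coeFn_toLp _

lemma dilateLp_mem_scaleSpace {f : ℝ → ℝ} (hf : MemLp f 2) (j k : ℤ) :
    dilateLp hf j k ∈ scaleSpace f j := by
  rw [scaleSpace_eq hf]
  exact Submodule.le_topologicalClosure _ (Submodule.subset_span ⟨k, rfl⟩)

/-! ### Hilbert space lemmas -/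

section Hilbert

variable {H ι : Type*} [NormedAddCommGroup H] [InnerProductSpace ℝ H]

lemma inner_eq_zero_of_mem_closure_span {a : ι → H} {u : H} (h : ∀ i, inner ℝ (a i) u = 0)
    {v : H} (hv : v ∈ (Submodule.span ℝ (Set.range a)).topologicalClosure) : inner ℝ v u = 0 := by
  have h1 : (Submodule.span ℝ (Set.range a)).topologicalClosure ≤ (Submodule.span ℝ {u})ᗮ := by
    refine Submodule.topologicalClosure_minimal _ (Submodule.span_le.2 ?_)
      (Submodule.isClosed_orthogonal _)
    rintro _ ⟨i, rfl⟩
    exact (Submodule.mem_orthogonal_singleton_iff_inner_left).2 (h i)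
  exact (Submodule.mem_orthogonal_singleton_iff_inner_left).1 (h1 hv)

lemma inner_sum_smul_eq_of_notMem {a : ι → H} (ha : Orthonormal ℝ a) {v : H} {T : Finset ι}
    (hT : ∀ i ∉ T, inner ℝ (a i) v = 0) (i : ι) :
    inner ℝ (a i) (∑ k ∈ T, inner ℝ (a k) v • a k) = inner ℝ (a i) v := by
  classical
  by_cases hi : i ∈ T
  · exact ha.inner_right_sum _ hi
  · rw [hT i hi, inner_sum]
    refine Finset.sum_eq_zero fun k hk => ?_
    rw [inner_smul_right, ha.2 (show i ≠ k from fun h => hi (h ▸ hk)), mul_zero]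

/-- A finite two-scale relation. -/
lemma eq_sum_add_sum_of_detail {a b : ι → H} (ha : Orthonormal ℝ a) (hb : Orthonormal ℝ b)
    {A B C : Submodule ℝ H} (hA : A = (Submodule.span ℝ (Set.range a)).topologicalClosure)
    (hB : B = (Submodule.span ℝ (Set.range b)).topologicalClosure) (hAC : A ≤ C)
    (hBC : B = C ⊓ Aᗮ) {v : H} (hv : v ∈ C) {S T : Finset ι}
    (hS : ∀ i ∉ S, inner ℝ (a i) v = 0) (hT : ∀ i ∉ T, inner ℝ (b i) v = 0) :
    v = ∑ i ∈ S, inner ℝ (a i) v • a i + ∑ i ∈ T, inner ℝ (b i) v • b i := by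
  have haA : ∀ i, a i ∈ A := fun i => by
    rw [hA]; exact Submodule.le_topologicalClosure _ (Submodule.subset_span ⟨i, rfl⟩)
  have hbB : ∀ i, b i ∈ B := fun i => by
    rw [hB]; exact Submodule.le_topologicalClosure _ (Submodule.subset_span ⟨i, rfl⟩)
  have hbC : ∀ i, b i ∈ C := fun i => by
    have := hbB i
    rw [hBC] at this
    exact this.1
  have hab : ∀ i k, inner ℝ (a i) (b k) = 0 := fun i k => by
    have := hbB k
    rw [hBC] at this
    exact (Submodule.mem_orthogonal _ _).1 this.2 _ (haA i)
  rw [← sub_eq_zero]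
  set p := ∑ i ∈ S, inner ℝ (a i) v • a i with hp
  set q := ∑ i ∈ T, inner ℝ (b i) v • b i with hq
  have haq : ∀ i, inner ℝ (a i) q = 0 := fun i => by
    rw [hq, inner_sum]
    exact Finset.sum_eq_zero fun k _ => by rw [inner_smul_right, hab, mul_zero]
  have hbp : ∀ i, inner ℝ (b i) p = 0 := fun i => by
    rw [hp, inner_sum]
    exact Finset.sum_eq_zero fun k _ => by
      rw [inner_smul_right, real_inner_comm (a k) (b i), hab, mul_zero]
  have hau : ∀ i, inner ℝ (a i) (v - (p + q)) = 0 := fun i => by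
    rw [inner_sub_right, inner_add_right, haq, add_zero, inner_sum_smul_eq_of_notMem ha hS, sub_self]
  have hbu : ∀ i, inner ℝ (b i) (v - (p + q)) = 0 := fun i => by
    rw [inner_sub_right, inner_add_right, hbp, zero_add, inner_sum_smul_eq_of_notMem hb hT, sub_self]
  have huC : v - (p + q) ∈ C := C.sub_mem hv (C.add_mem
    (C.sum_mem fun i _ => C.smul_mem _ (hAC (haA i))) (C.sum_mem fun i _ => C.smul_mem _ (hbC i)))
  -- The remainder lies in `C` and is orthogonal to `A`, hence lies in `B`; being orthogonal to the
  -- generators of `B` as well, it is zero.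
  have huB : v - (p + q) ∈ B := by
    rw [hBC]
    refine ⟨huC, (Submodule.mem_orthogonal _ _).2 fun w hw => ?_⟩
    rw [hA] at hw
    exact inner_eq_zero_of_mem_closure_span hau hw
  rw [hB] at huB
  exact inner_self_eq_zero.1 (inner_eq_zero_of_mem_closure_span hbu huB)

/-- Best approximation in the span of an orthonormal family. -/
lemma norm_sub_sum_inner_le {a : ι → H} (ha : Orthonormal ℝ a) (g v : H)
    (hv : v ∈ Submodule.span ℝ (Set.range a)) {T : Finset ι} (hT : ∀ i ∉ T, inner ℝ (a i) g = 0) :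
    ‖g - ∑ i ∈ T, inner ℝ (a i) g • a i‖ ≤ ‖g - v‖ := by
  set h := ∑ i ∈ T, inner ℝ (a i) g • a i with hh
  have h1 : ∀ i, inner ℝ (a i) (g - h) = 0 := fun i => by
    rw [inner_sub_right, inner_sum_smul_eq_of_notMem ha hT, sub_self]
  have h2 : h - v ∈ Submodule.span ℝ (Set.range a) :=
    Submodule.sub_mem _ (Submodule.sum_mem _ fun i _ =>
      Submodule.smul_mem _ _ (Submodule.subset_span ⟨i, rfl⟩)) hv
  have h3 := inner_eq_zero_of_mem_closure_span h1 (Submodule.le_topologicalClosure _ h2)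
  have h4 : ‖g - v‖ ^ 2 = ‖h - v‖ ^ 2 + ‖g - h‖ ^ 2 := by
    rw [show g - v = (h - v) + (g - h) by abel, norm_add_sq_real, h3]
    ring
  nlinarith [norm_nonneg (g - v), norm_nonneg (g - h), sq_nonneg ‖h - v‖,
    pow_le_pow_left₀ (norm_nonneg (g - v)) le_rfl 2]

end Hilbert

end SIET

end

noncomputable section

namespace SIET

/-! ### The periodized wavelet basis of `L²[0,1]` -/

/-- An integer shift of the variable changes the translation index by a multiple of 2^j, so a
periodized wavelet depends only on that index modulo 2^j. -/
lemma periodize_dilate_sub (f : ℝ → ℝ) (j : ℕ) (k n : ℤ) (x : ℝ) :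
    periodize (dilate f j (k - 2 ^ j * n)) x = periodize (dilate f j k) x := by
  rw [← periodize_add_int (dilate f j k) x n, periodize, periodize]
  refine tsum_congr fun l => ?_
  rw [← dilate_add_int, add_right_comm]

lemma periodize_dilate_eq_periodic (f : ℝ → ℝ) (j : ℕ) (k : ℤ) :
    ∃ k₀ : Fin (2 ^ j), ∀ x : I, periodize (dilate f j k) x = periodic f j k₀ x := by
  have hpos : (0 : ℤ) < 2 ^ j := by positivity
  have h0 := Int.emod_nonneg k hpos.ne'
  have h1 := Int.emod_lt_of_pos k hpos
  refine ⟨⟨(k % 2 ^ j).toNat, by zify; rwa [Int.toNat_of_nonneg h0]⟩, fun x => ?_⟩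
  rw [← periodize_dilate_sub f j k (k / 2 ^ j), ← Int.emod_def]
  simp only [periodic, Int.toNat_of_nonneg h0]
  rfl

variable {φ ψ : ℝ → ℝ}

/-- The index set of the periodized wavelet basis: the father wavelet and the mother wavelets. -/
abbrev WaveletIndex : Type := Option (Σ j : ℕ, Fin (2 ^ j))

/-- The periodized wavelets. -/
def periodicWavelet (φ ψ : ℝ → ℝ) : WaveletIndex → I → ℝ
  | none => periodic φ 0 0
  | some a => periodic ψ a.1 a.2

lemma IsWavelet.exists_vanishesBeyond_father (hw : IsWavelet φ ψ) (j k : ℤ) :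
    ∃ M, VanishesBeyond M (dilate φ j k) :=
  exists_vanishesBeyond_dilate (exists_vanishesBeyond hw.compact_father) j k

lemma IsWavelet.exists_vanishesBeyond_mother (hw : IsWavelet φ ψ) (j k : ℤ) :
    ∃ M, VanishesBeyond M (dilate ψ j k) :=
  exists_vanishesBeyond_dilate (exists_vanishesBeyond hw.compact_mother) j k

lemma memLp_periodize_dilate {f : ℝ → ℝ} (hf : MemLp f 2) (hfc : HasCompactSupport f) (j k : ℤ) :
    MemLp (fun x : I => periodize (dilate f j k) x) 2 := by
  obtain ⟨M, hM⟩ := exists_vanishesBeyond_dilate (exists_vanishesBeyond hfc) j k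
  exact hM.memLp_periodize (memLp_dilate hf j k)

lemma IsWavelet.memLp_periodicWavelet (hw : IsWavelet φ ψ) (e : WaveletIndex) :
    MemLp (periodicWavelet φ ψ e) 2 := by
  cases e with
  | none => exact memLp_periodize_dilate hw.memLp_father hw.compact_father _ _
  | some a => exact memLp_periodize_dilate hw.memLp_mother hw.compact_mother _ _

lemma IsWavelet.orthonormal_father' (hw : IsWavelet φ ψ) (j : ℤ) :
    Orthonormal ℝ (dilateLp hw.memLp_father j) := by
  classical
  rw [orthonormal_iff_ite]
  intro k k'
  rw [inner_dilateLp, hw.orthonormal_father]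

lemma IsWavelet.orthonormal_mother' (hw : IsWavelet φ ψ) (j : ℤ) :
    Orthonormal ℝ (dilateLp hw.memLp_mother j) := by
  classical
  rw [orthonormal_iff_ite]
  intro k k'
  rw [inner_dilateLp, hw.orthonormal_mother]
  simp

lemma IsWavelet.monotone_scaleSpace (hw : IsWavelet φ ψ) : Monotone (scaleSpace φ) :=
  monotone_int_of_le_succ hw.nested

/-- The space V_j is contained in V_{j'}, and W_{j'} is orthogonal to V_{j'}. -/
lemma IsWavelet.integral_father_mul_mother (hw : IsWavelet φ ψ) {j j' : ℤ} (hj : j ≤ j')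
    (k k' : ℤ) : ∫ x, dilate φ j k x * dilate ψ j' k' x = 0 := by
  rw [← inner_dilateLp hw.memLp_father hw.memLp_mother]
  have h1 := hw.monotone_scaleSpace hj (dilateLp_mem_scaleSpace hw.memLp_father j k)
  have h2 := dilateLp_mem_scaleSpace hw.memLp_mother j' k'
  rw [hw.detail] at h2
  exact (Submodule.mem_orthogonal _ _).1 h2.2 _ h1

/-- Inner products of periodized wavelets as finite sums of inner products of wavelets. -/
lemma integral_periodic_mul_periodic {f g : ℝ → ℝ} (hf : MemLp f 2) (hg : MemLp g 2)
    (hfc : HasCompactSupport f) (hgc : HasCompactSupport g) (j k j' k' : ℕ) :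
    ∃ M : ℕ, ∫ x : I, periodic f j k x * periodic g j' k' x =
      ∑ n ∈ Finset.Icc (-(M : ℤ)) M,
        ∫ x, dilate f j k x * dilate g j' ((k' : ℤ) - 2 ^ j' * n) x := by
  obtain ⟨M, hM⟩ := exists_vanishesBeyond_dilate (exists_vanishesBeyond hfc) j k
  obtain ⟨N, hN⟩ := exists_vanishesBeyond_dilate (exists_vanishesBeyond hgc) j' k'
  refine ⟨max M N + max M N, ?_⟩
  refine ((hM.mono (le_max_left M N)).integral_periodize_mul_periodize
    (hN.mono (le_max_right M N)) (memLp_dilate hf j k) (memLp_dilate hg j' k')).trans ?_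
  simp_rw [dilate_add_int]

/-- Unfolding gives a finite sum of inner products on the line, and orthonormality there leaves at
most the term n = 0. -/
lemma IsWavelet.integral_periodicWavelet_mul (hw : IsWavelet φ ψ) (e e' : WaveletIndex) :
    ∫ x, periodicWavelet φ ψ e x * periodicWavelet φ ψ e' x = if e = e' then 1 else 0 := by
  have cross : ∀ a : Σ j : ℕ, Fin (2 ^ j),
      ∫ x, periodicWavelet φ ψ none x * periodicWavelet φ ψ (some a) x = 0 := by
    intro a
    obtain ⟨M, hM⟩ := integral_periodic_mul_periodic hw.memLp_father hw.memLp_mother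
      hw.compact_father hw.compact_mother 0 0 a.1 a.2
    refine hM.trans (Finset.sum_eq_zero fun n _ => ?_)
    exact hw.integral_father_mul_mother (by simp) _ _
  rcases e with _ | ⟨j, k⟩ <;> rcases e' with _ | ⟨j', k'⟩
  · obtain ⟨M, hM⟩ := integral_periodic_mul_periodic hw.memLp_father hw.memLp_father
      hw.compact_father hw.compact_father 0 0 0 0
    refine hM.trans ?_
    rw [if_pos rfl, Finset.sum_eq_single 0]
    · rw [hw.orthonormal_father]; simp
    · intro n _ hn
      refine (hw.orthonormal_father _ _ _).trans (if_neg fun h => hn ?_)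
      norm_num at h
      omega
    · intro h
      simp at h
  · rw [cross]; simp
  · simp_rw [mul_comm (periodicWavelet φ ψ (some _) _)]
    rw [cross]; simp
  · obtain ⟨M, hM⟩ := integral_periodic_mul_periodic hw.memLp_mother hw.memLp_mother
      hw.compact_mother hw.compact_mother j k j' k'
    refine hM.trans ?_
    simp_rw [hw.orthonormal_mother]
    by_cases hj : j = j'
    swap
    · have : ¬ (some (⟨j, k⟩ : Σ j : ℕ, Fin (2 ^ j)) = some ⟨j', k'⟩) := by
        simp only [Option.some.injEq, Sigma.mk.injEq, not_and]
        exact fun h => absurd h hj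
      rw [if_neg this]
      exact Finset.sum_eq_zero fun n _ => if_neg fun h => hj (by exact_mod_cast h.1)
    subst hj
    have hk := k.2
    have hk' := k'.2
    -- Two indices in [0, 2^j) that differ by a multiple of 2^j coincide.
    have key : ∀ n : ℤ, (k : ℤ) = k' - 2 ^ j * n → n = 0 := by
      intro n hn
      have h1 : ((k : ℕ) : ℤ) < 2 ^ j := by exact_mod_cast hk
      have h2 : ((k' : ℕ) : ℤ) < 2 ^ j := by exact_mod_cast hk'
      by_contra h0
      rcases lt_or_gt_of_ne h0 with h | h
      · nlinarith [(by positivity : (0 : ℤ) < 2 ^ j)]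
      · nlinarith [(by positivity : (0 : ℤ) < 2 ^ j)]
    rw [Finset.sum_eq_single 0]
    · simp [Fin.ext_iff]
    · intro n _ hn
      exact if_neg fun h => hn (key n h.2)
    · intro h
      simp at h

/-- The finite two-scale relation, almost everywhere. -/
lemma IsWavelet.exists_two_scale (hw : IsWavelet φ ψ) (j k : ℤ) :
    ∃ (S T : Finset ℤ) (c d : ℤ → ℝ), dilate φ (j + 1) k =ᵐ[volume]
      fun x => (∑ l ∈ S, c l * dilate φ j l x) + ∑ l ∈ T, d l * dilate ψ j l x := by
  obtain ⟨R, hR⟩ := hw.exists_vanishesBeyond_father (j + 1) k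
  obtain ⟨M, hM⟩ := exists_vanishesBeyond hw.compact_father
  obtain ⟨N, hN⟩ := exists_vanishesBeyond hw.compact_mother
  obtain ⟨S, hS⟩ := hM.exists_finset_dilate hR j
  obtain ⟨T, hT⟩ := hN.exists_finset_dilate hR j
  have key := eq_sum_add_sum_of_detail (hw.orthonormal_father' j) (hw.orthonormal_mother' j)
    (scaleSpace_eq hw.memLp_father j) (scaleSpace_eq hw.memLp_mother j) (hw.nested j)
    (hw.detail j) (dilateLp_mem_scaleSpace hw.memLp_father (j + 1) k) (S := S) (T := T)
    (fun l hl => by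
      rw [real_inner_comm, inner_dilateLp]
      simp [hS l hl])
    (fun l hl => by
      rw [real_inner_comm, inner_dilateLp]
      simp [hT l hl])
  set c : ℤ → ℝ := fun l =>
    inner ℝ (dilateLp hw.memLp_father j l) (dilateLp hw.memLp_father (j + 1) k)
  set d : ℤ → ℝ := fun l =>
    inner ℝ (dilateLp hw.memLp_mother j l) (dilateLp hw.memLp_father (j + 1) k)
  refine ⟨S, T, c, d, ?_⟩
  have hc : ∀ l, ⇑(c l • dilateLp hw.memLp_father j l) =ᵐ[volume] fun x => c l * dilate φ j l x :=
    fun l => (Lp.coeFn_smul _ _).trans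
      ((MemLp.coeFn_toLp (memLp_dilate hw.memLp_father j l)).mono fun x hx => by
        simp only [Pi.smul_apply, smul_eq_mul]; rw [← hx]; rfl)
  have hd : ∀ l, ⇑(d l • dilateLp hw.memLp_mother j l) =ᵐ[volume] fun x => d l * dilate ψ j l x :=
    fun l => (Lp.coeFn_smul _ _).trans
      ((MemLp.coeFn_toLp (memLp_dilate hw.memLp_mother j l)).mono fun x hx => by
        simp only [Pi.smul_apply, smul_eq_mul]; rw [← hx]; rfl)
  have e1 := MemLp.coeFn_toLp (memLp_dilate hw.memLp_father (j + 1) k)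
  have e2 := Lp.coeFn_add (∑ l ∈ S, c l • dilateLp hw.memLp_father j l)
    (∑ l ∈ T, d l • dilateLp hw.memLp_mother j l)
  rw [← key] at e2
  refine e1.symm.trans (e2.trans ?_)
  have e3 := Lp.coeFn_finsetSum S fun l => c l • dilateLp hw.memLp_father j l
  have e4 := Lp.coeFn_finsetSum T fun l => d l • dilateLp hw.memLp_mother j l
  filter_upwards [e3, e4, ae_all_iff.2 hc, ae_all_iff.2 hd] with x h3 h4 h5 h6
  simp only [Pi.add_apply]
  rw [h3, h4]
  simp [h5, h6]

end SIET

end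

noncomputable section

namespace SIET

variable {φ ψ : ℝ → ℝ}

/-! ### Completeness of the periodized wavelet basis -/

lemma integral_mul_sum {ι : Type*} {β : I → ℝ} (hβ : MemLp β 2) (s : Finset ι) (c : ι → ℝ)
    {g : ι → I → ℝ} (hg : ∀ i, MemLp (g i) 2) :
    ∫ x, β x * ∑ i ∈ s, c i * g i x = ∑ i ∈ s, c i * ∫ x, β x * g i x := by
  simp_rw [Finset.mul_sum]
  rw [integral_finsetSum]
  · refine Finset.sum_congr rfl fun i _ => ?_
    rw [← integral_const_mul]
    congr 1 with x
    ring
  · exact fun i _ => hβ.integrable_mul ((hg i).const_mul (c i))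

/-- Induction over the scales: the two-scale relation writes each father wavelet of scale j+1
through father and mother wavelets of scale j, all orthogonal to `β` after periodization. -/
lemma IsWavelet.integral_mul_periodize_father_eq_zero (hw : IsWavelet φ ψ) {β : I → ℝ}
    (hβ : MemLp β 2) (h : ∀ e, ∫ x, β x * periodicWavelet φ ψ e x = 0) (j : ℕ) :
    ∀ k : ℤ, ∫ x : I, β x * periodize (dilate φ j k) x = 0 := by
  induction j with
  | zero =>
    intro k
    obtain ⟨k₀, hk₀⟩ := periodize_dilate_eq_periodic φ 0 k
    simp_rw [hk₀]
    -- At scale 0 all translates have the same periodization.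
    have : (k₀ : ℕ) = 0 := by have := k₀.2; omega
    rw [this]
    exact h none
  | succ j ih =>
    intro k
    have hψ : ∀ k : ℤ, ∫ x : I, β x * periodize (dilate ψ j k) x = 0 := by
      intro k
      obtain ⟨k₀, hk₀⟩ := periodize_dilate_eq_periodic ψ j k
      simp_rw [hk₀]
      exact h (some ⟨j, k₀⟩)
    obtain ⟨S, T, c, d, hcd⟩ := hw.exists_two_scale j k
    have hφm := fun l : ℤ => memLp_periodize_dilate hw.memLp_father hw.compact_father j l
    have hψm := fun l : ℤ => memLp_periodize_dilate hw.memLp_mother hw.compact_mother j l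
    have hper : ∀ x, periodize (fun x => (∑ l ∈ S, c l * dilate φ j l x) +
        ∑ l ∈ T, d l * dilate ψ j l x) x =
        (∑ l ∈ S, c l * periodize (dilate φ j l) x) +
          ∑ l ∈ T, d l * periodize (dilate ψ j l) x := by
      intro x
      choose M hM using fun l => hw.exists_vanishesBeyond_father j l
      choose N hN using fun l => hw.exists_vanishesBeyond_mother j l
      have h1 : VanishesBeyond (S.sup M) fun x => ∑ l ∈ S, c l * dilate φ j l x :=
        VanishesBeyond.sum S c fun l hl => (hM l).mono (Finset.le_sup hl)
      have h2 : VanishesBeyond (T.sup N) fun x => ∑ l ∈ T, d l * dilate ψ j l x :=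
        VanishesBeyond.sum T d fun l hl => (hN l).mono (Finset.le_sup hl)
      rw [(h1.mono (le_max_left _ (T.sup N))).periodize_add (h2.mono (le_max_right _ _)),
        periodize_sum S c (fun l => ⟨_, hM l⟩), periodize_sum T d (fun l => ⟨_, hN l⟩)]
    have hae := ae_periodize_eq hcd
    have : ∫ x : I, β x * periodize (dilate φ ((j + 1 : ℕ) : ℤ) k) x =
        ∫ x : I, (β x * (∑ l ∈ S, c l * periodize (dilate φ j l) x) +
          β x * ∑ l ∈ T, d l * periodize (dilate ψ j l) x) := by
      refine integral_congr_ae ?_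
      filter_upwards [hae] with x hx
      rw [← mul_add, ← hper]
      push_cast
      rw [hx]
    rw [this, integral_add, integral_mul_sum hβ S c hφm, integral_mul_sum hβ T d hψm]
    · simp [ih, hψ]
    · exact hβ.integrable_mul (memLp_finsetSum S fun l _ => (hφm l).const_mul (c l))
    · exact hβ.integrable_mul (memLp_finsetSum T fun l _ => (hψm l).const_mul (d l))

/-- The scale spaces approximate every function in `L²(ℝ)` at arbitrarily fine scales. -/
lemma IsWavelet.exists_mem_span_norm_sub_lt (hw : IsWavelet φ ψ)
    (g : Lp ℝ 2 (volume : Measure ℝ)) {ε : ℝ} (hε : 0 < ε) :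
    ∃ j : ℕ, ∃ v ∈ Submodule.span ℝ (Set.range (dilateLp hw.memLp_father j)), ‖g - v‖ < ε := by
  have hg : g ∈ (⨆ j, scaleSpace φ j).topologicalClosure := by rw [hw.dense]; trivial
  rw [← SetLike.mem_coe, Submodule.topologicalClosure_coe, Metric.mem_closure_iff] at hg
  obtain ⟨v, hv, hgv⟩ := hg (ε / 2) (half_pos hε)
  rw [SetLike.mem_coe, Submodule.mem_iSup_of_directed _ hw.monotone_scaleSpace.directed_le] at hv
  obtain ⟨j, hv⟩ := hv
  -- The scale found may be negative; nestedness allows raising it to a natural number.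
  have hv := hw.monotone_scaleSpace (Int.self_le_toNat j) hv
  rw [scaleSpace_eq hw.memLp_father, ← SetLike.mem_coe, Submodule.topologicalClosure_coe,
    Metric.mem_closure_iff] at hv
  obtain ⟨w, hw', hvw⟩ := hv (ε / 2) (half_pos hε)
  refine ⟨j.toNat, w, hw', ?_⟩
  rw [← dist_eq_norm]
  linarith [dist_triangle g v w]

lemma norm_toLp_sq {α : Type*} [MeasurableSpace α] {μ : Measure α} {f : α → ℝ} (hf : MemLp f 2 μ) :
    ‖hf.toLp‖ ^ 2 = ∫ x, f x ^ 2 ∂μ := by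
  rw [← real_inner_self_eq_norm_sq, inner_toLp]
  simp_rw [sq]

/-- Functions supported in `[0,1]` are approximated by combinations of `φ_{j,k}` with supports in a
fixed bounded set. -/
lemma IsWavelet.exists_approx (hw : IsWavelet φ ψ) {g : ℝ → ℝ} (hg : MemLp g 2)
    (hg1 : VanishesBeyond 1 g) :
    ∃ M : ℕ, ∀ ε > 0, ∃ (j : ℕ) (T : Finset ℤ) (c : ℤ → ℝ),
      (∀ k ∈ T, VanishesBeyond M (dilate φ j k)) ∧
      ∫ x, (g x - ∑ k ∈ T, c k * dilate φ j k x) ^ 2 < ε := by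
  obtain ⟨M, hM⟩ := exists_vanishesBeyond hw.compact_father
  -- From |k| ≤ M + 2^j and |2^j x - k| ≤ M follows |x| ≤ 2M + 1. The bound is independent of `ε`,
  -- as the later use of `integral_periodize_sq_le` requires.
  refine ⟨2 * M + 1, fun ε hε => ?_⟩
  obtain ⟨j, v, hv, hgv⟩ := hw.exists_mem_span_norm_sub_lt hg.toLp (Real.sqrt_pos.2 hε)
  set T : Finset ℤ := Finset.Icc (-((M + 2 ^ j : ℕ) : ℤ)) (M + 2 ^ j : ℕ) with hT
  have hmem : ∀ k : ℤ, k ∈ T ↔ |(k : ℝ)| ≤ M + 2 ^ j := by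
    intro k
    rw [hT, Finset.mem_Icc, ← abs_le]
    constructor
    · intro h
      exact_mod_cast h
    · intro h
      exact_mod_cast h
  have hout : ∀ k ∉ T, ∀ x, g x * dilate φ j k x = 0 := by
    intro k hk
    refine hM.dilate_mul_eq_zero hg1 ?_
    rw [hmem, not_le] at hk
    rw [zpow_natCast]
    simpa using hk
  -- The approximant `v` may have translates far from [0,1]. The orthogonal projection of `g` is at
  -- least as close and uses only translates meeting the support of `g`.
  have key := norm_sub_sum_inner_le (hw.orthonormal_father' j) hg.toLp v hv (T := T)
    (fun k hk => by
      rw [real_inner_comm, dilateLp, inner_toLp]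
      simp [hout k hk])
  set c : ℤ → ℝ := fun k => inner ℝ (dilateLp hw.memLp_father j k) hg.toLp with hc
  refine ⟨j, T, c, fun k hk x hx => hM.dilate_eq_zero ?_, ?_⟩
  · rw [hmem] at hk
    have h1 := abs_sub_abs_le_abs_sub ((2 : ℝ) ^ (j : ℤ) * x) k
    have hpos : (1 : ℝ) ≤ 2 ^ j := one_le_pow₀ one_le_two
    rw [abs_mul, zpow_natCast, abs_of_pos (by positivity)] at h1
    rw [zpow_natCast]
    push_cast at hx
    have : (2 * (M : ℝ) + 1) * 2 ^ j < 2 ^ j * |x| := by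
      rw [mul_comm]; exact mul_lt_mul_of_pos_left hx (by positivity)
    have : (M : ℝ) ≤ M * 2 ^ j := le_mul_of_one_le_right (Nat.cast_nonneg _) hpos
    linarith
  · have hsum : MemLp (fun x => ∑ k ∈ T, c k * dilate φ j k x) 2 :=
      memLp_finsetSum T fun k _ => (memLp_dilate hw.memLp_father j k).const_mul (c k)
    have hsub : MemLp (fun x => g x - ∑ k ∈ T, c k * dilate φ j k x) 2 := hg.sub hsum
    have heq : hsub.toLp = hg.toLp - ∑ k ∈ T, c k • dilateLp hw.memLp_father j k := by
      have : hsum.toLp = ∑ k ∈ T, c k • dilateLp hw.memLp_father j k := by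
        refine Lp.ext (hsum.coeFn_toLp.trans ?_)
        have e3 := Lp.coeFn_finsetSum T fun k => c k • dilateLp hw.memLp_father j k
        have e4 : ∀ k, ⇑(c k • dilateLp hw.memLp_father j k) =ᵐ[volume]
            fun x => c k * dilate φ j k x := fun k => (Lp.coeFn_smul _ _).trans
          ((MemLp.coeFn_toLp (memLp_dilate hw.memLp_father j k)).mono fun x hx => by
            simp only [Pi.smul_apply, smul_eq_mul]; rw [← hx]; rfl)
        filter_upwards [e3, ae_all_iff.2 e4] with x h3 h4
        rw [h3]
        simp [h4]
      rw [← this]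
      rfl
    rw [← norm_toLp_sq hsub, heq]
    have h3 := key.trans_lt hgv
    calc _ < √ε ^ 2 := by gcongr
      _ = ε := Real.sq_sqrt hε.le

/-- A function orthogonal to all periodized wavelets vanishes. -/
lemma IsWavelet.ae_eq_zero_of_orthogonal (hw : IsWavelet φ ψ) {β : I → ℝ}
    (hβ : MemLp β 2) (h : ∀ e, ∫ x, β x * periodicWavelet φ ψ e x = 0) : β =ᵐ[volume] 0 := by
  set g : ℝ → ℝ := Function.extend ((↑) : I → ℝ) β 0 with hgdef
  have hgβ : ∀ x : I, g x = β x := fun x => Subtype.val_injective.extend_apply _ _ _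
  have hg0 : ∀ x : ℝ, x ∉ I → g x = 0 := fun x hx =>
    Function.extend_apply' _ _ _ (fun ⟨y, hy⟩ => hx (hy ▸ y.2))
  have hg : MemLp g 2 := by
    have hind : g = (Set.Icc (0 : ℝ) 1).indicator g := by
      ext x
      by_cases hx : x ∈ Set.Icc (0 : ℝ) 1
      · rw [Set.indicator_of_mem hx]
      · rw [Set.indicator_of_notMem hx, hg0 x hx]
    rw [hind, memLp_indicator_iff_restrict measurableSet_Icc,
      ← measurePreserving_coe_unitInterval.map_eq,
      (MeasurableEmbedding.subtype_coe measurableSet_Icc).memLp_map_measure_iff]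
    have hcomp : g ∘ ((↑) : I → ℝ) = β := funext hgβ
    rw [hcomp]
    exact hβ
  have hg1 : VanishesBeyond 1 g := fun x hx => hg0 x fun hx' => by
    have := abs_coe_unitInterval_le ⟨x, hx'⟩
    exact absurd hx (not_lt.2 this)
  -- At 0 and at 1 the periodization adds both end values, so the identity is claimed only almost
  -- everywhere.
  have hper : (fun x : I => periodize g x) =ᵐ[volume] β := by
    have hne : ∀ᵐ x : I, x ≠ 0 ∧ x ≠ 1 := by
      have h0 : ∀ᵐ x : I, x ≠ 0 := by simp [ae_iff]
      have h1 : ∀ᵐ x : I, x ≠ 1 := by simp [ae_iff]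
      exact h0.and h1
    filter_upwards [hne] with x hx
    have hx0 : (0 : ℝ) < x := unitInterval.pos_iff_ne_zero.2 hx.1
    have hx1 : (x : ℝ) < 1 := unitInterval.lt_one_iff_ne_one.2 hx.2
    rw [periodize, tsum_eq_single 0]
    · simp [hgβ]
    · intro l hl
      refine hg0 _ fun hxl => hl ?_
      have h1 : (-1 : ℝ) < l := by linarith [hxl.1]
      have h2 : (l : ℝ) < 1 := by linarith [hxl.2]
      have h1' : (-1 : ℤ) < l := by exact_mod_cast h1
      have h2' : l < 1 := by exact_mod_cast h2
      omega
  obtain ⟨M, hM⟩ := hw.exists_approx hg hg1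
  -- The function `β` is orthogonal to the periodized approximant, so its squared norm is at most
  -- that of the difference, which is the periodization of the small error on the line.
  have hβ2 : ∀ ε > 0, ∫ x, β x ^ 2 ≤ (4 * (M + 1 : ℕ) + 1) * ε := by
    intro ε hε
    obtain ⟨j, T, c, hT, hlt⟩ := hM ε hε
    set p : ℝ → ℝ := fun x => ∑ k ∈ T, c k * dilate φ j k x with hp
    have hpM : VanishesBeyond M p := VanishesBeyond.sum T c hT
    have hp2 : MemLp p 2 :=
      memLp_finsetSum T fun k _ => (memLp_dilate hw.memLp_father j k).const_mul (c k)
    have hd : VanishesBeyond (M + 1) fun x => g x + (-1) * p x := fun x hx => by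
      simp [hg1.mono (Nat.le_add_left 1 M) x hx, hpM.mono (Nat.le_add_right M 1) x hx]
    have hd2 : MemLp (fun x => g x + (-1) * p x) 2 := hg.add (hp2.const_mul _)
    have hle := hd.integral_periodize_sq_le hd2
    have hperp : ∀ x : I, periodize p x = ∑ k ∈ T, c k * periodize (dilate φ j k) x := fun x =>
      periodize_sum T c (fun k => hw.exists_vanishesBeyond_father j k) x
    have hpp : MemLp (fun x : I => periodize p x) 2 := hpM.memLp_periodize hp2
    have horth : ∫ x : I, β x * periodize p x = 0 := by
      simp_rw [hperp]
      rw [integral_mul_sum hβ T c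
        fun k => memLp_periodize_dilate hw.memLp_father hw.compact_father j k]
      simp [hw.integral_mul_periodize_father_eq_zero hβ h j]
    have heq : (fun x : I => periodize (fun x => g x + (-1) * p x) x ^ 2) =ᵐ[volume]
        fun x : I => β x ^ 2 - 2 * (β x * periodize p x) + periodize p x ^ 2 := by
      filter_upwards [hper] with x hx
      have : periodize (fun x => g x + (-1) * p x) x = periodize g x + (-1) * periodize p x := by
        have hn : VanishesBeyond (M + 1) fun x => (-1) * p x := fun x hx => by
          simp [hpM.mono (Nat.le_add_right M 1) x hx]
        rw [(hg1.mono (Nat.le_add_left 1 M)).periodize_add hn]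
        congr 1
        exact tsum_mul_left
      rw [this, hx]
      ring
    rw [integral_congr_ae heq, integral_add, integral_sub, integral_const_mul, horth] at hle
    · have h1 : 0 ≤ ∫ x : I, periodize p x ^ 2 := integral_nonneg fun x => sq_nonneg _
      have h2 : ∫ x, (g x + (-1) * p x) ^ 2 = ∫ x, (g x - ∑ k ∈ T, c k * dilate φ j k x) ^ 2 := by
        congr 1 with x
        ring
      have h3 : (0 : ℝ) ≤ 4 * (M + 1 : ℕ) + 1 := by positivity
      rw [h2] at hle
      have := mul_le_mul_of_nonneg_left hlt.le h3
      linarith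
    · exact hβ.integrable_sq
    · exact (hβ.integrable_mul hpp).const_mul 2
    · exact hβ.integrable_sq.sub ((hβ.integrable_mul hpp).const_mul 2)
    · exact hpp.integrable_sq
  have hzero : ∫ x, β x ^ 2 = 0 := by
    refine le_antisymm (le_of_forall_pos_le_add fun δ hδ => ?_) (integral_nonneg fun x => sq_nonneg _)
    have hC : (0 : ℝ) < 4 * (M + 1 : ℕ) + 1 := by positivity
    refine (hβ2 (δ / (4 * (M + 1 : ℕ) + 1)) (by positivity)).trans ?_
    rw [mul_div_cancel₀ _ hC.ne', zero_add]
  have := (integral_eq_zero_iff_of_nonneg (fun x => sq_nonneg (β x)) hβ.integrable_sq).1 hzero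
  filter_upwards [this] with x hx
  simpa using hx

/-- The periodized wavelets in `L²[0,1]`. -/
def IsWavelet.waveletLp (hw : IsWavelet φ ψ) (e : WaveletIndex) : Lp ℝ 2 (volume : Measure I) :=
  (hw.memLp_periodicWavelet e).toLp

lemma IsWavelet.orthonormal_waveletLp (hw : IsWavelet φ ψ) : Orthonormal ℝ hw.waveletLp := by
  classical
  rw [orthonormal_iff_ite]
  intro e e'
  rw [IsWavelet.waveletLp, IsWavelet.waveletLp, inner_toLp, hw.integral_periodicWavelet_mul]

/-- The periodized wavelets form a Hilbert basis of `L²[0,1]`. -/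
def IsWavelet.hilbertBasis (hw : IsWavelet φ ψ) :
    HilbertBasis WaveletIndex ℝ (Lp ℝ 2 (volume : Measure I)) :=
  HilbertBasis.mkOfOrthogonalEqBot hw.orthonormal_waveletLp <| by
    rw [Submodule.eq_bot_iff]
    intro f hf
    have hfm : MemLp f 2 := Lp.memLp f
    have h : ∀ e, ∫ x, f x * periodicWavelet φ ψ e x = 0 := by
      intro e
      rw [← inner_toLp hfm (hw.memLp_periodicWavelet e), Lp.toLp_coeFn, real_inner_comm]
      exact (Submodule.mem_orthogonal _ _).1 hf _ (Submodule.subset_span ⟨e, rfl⟩)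
    exact (Lp.eq_zero_iff_ae_eq_zero).2 (hw.ae_eq_zero_of_orthogonal hfm h)

@[simp]
lemma IsWavelet.hilbertBasis_apply (hw : IsWavelet φ ψ) (e : WaveletIndex) :
    hw.hilbertBasis e = hw.waveletLp e := by
  simp [IsWavelet.hilbertBasis]

end SIET

end

noncomputable section

namespace SIET

/-! ### Step functions -/

/-- The `i`-th of `m` cells of `[0,1]`. -/
def cell (m : ℕ) (i : Fin m) : Set I := {x | (x : ℝ) ∈ Set.Ico ((i : ℝ) / m) (((i : ℝ) + 1) / m)}

lemma measurableSet_cell (m : ℕ) (i : Fin m) : MeasurableSet (cell m i) :=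
  measurable_subtype_coe measurableSet_Ico

lemma cast_pos_of_fin {m : ℕ} (i : Fin m) : (0 : ℝ) < m := by
  exact_mod_cast (Nat.zero_le _).trans_lt i.isLt

lemma measureReal_cell (m : ℕ) (i : Fin m) : volume.real (cell m i) = 1 / m := by
  have hm := cast_pos_of_fin i
  have h1 : ((↑) : I → ℝ) '' cell m i = Set.Ico ((i : ℝ) / m) (((i : ℝ) + 1) / m) := by
    rw [cell, ← Set.preimage_ofPred_eq, Set.ofPred_mem_eq, Set.image_preimage_eq_iff,
      Subtype.range_coe]
    intro x hx
    have hi : (i : ℝ) + 1 ≤ m := by exact_mod_cast i.isLt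
    exact ⟨(by positivity : (0 : ℝ) ≤ i / m).trans hx.1,
      hx.2.le.trans ((div_le_one hm).2 hi)⟩
  rw [measureReal_def, unitInterval.volume_apply, h1, Real.volume_Ico, ENNReal.toReal_ofReal]
  · ring
  · rw [← sub_div]
    simp

lemma step_eq_sum {m : ℕ} (Y : Fin m → ℝ) (x : I) :
    step Y x = ∑ i, (cell m i).indicator (fun _ => Y i) x := rfl

lemma index_eq_of_mem_cell {m : ℕ} {i j : Fin m} {x : I} (hi : x ∈ cell m i) (hj : x ∈ cell m j) :
    i = j := by
  have hm := cast_pos_of_fin i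
  have h1 := hi.1.trans_lt hj.2
  have h2 := hj.1.trans_lt hi.2
  rw [div_lt_div_iff_of_pos_right hm] at h1 h2
  have h1' : (i : ℕ) < j + 1 := by exact_mod_cast h1
  have h2' : (j : ℕ) < i + 1 := by exact_mod_cast h2
  exact Fin.ext (by omega)

lemma step_of_mem_cell {m : ℕ} (Y : Fin m → ℝ) {i : Fin m} {x : I} (hi : x ∈ cell m i) :
    step Y x = Y i := by
  rw [step_eq_sum, Finset.sum_eq_single i]
  · exact Set.indicator_of_mem hi _
  · intro j _ hj
    exact Set.indicator_of_notMem (fun h => hj (index_eq_of_mem_cell h hi)) _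
  · simp

lemma exists_mem_cell {m : ℕ} (hm : 0 < m) {x : I} (hx : x ≠ 1) : ∃ i, x ∈ cell m i := by
  have hm' : (0 : ℝ) < m := by exact_mod_cast hm
  have hx1 : (x : ℝ) < 1 := unitInterval.lt_one_iff_ne_one.2 hx
  have h0 : 0 ≤ (x : ℝ) * m := mul_nonneg x.2.1 hm'.le
  refine ⟨⟨⌊(x : ℝ) * m⌋₊, (Nat.floor_lt h0).2 ?_⟩, ?_, ?_⟩
  · exact mul_lt_of_lt_one_left hm' hx1
  · rw [div_le_iff₀ hm']; exact Nat.floor_le h0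
  · rw [lt_div_iff₀ hm']; exact Nat.lt_floor_add_one _

lemma ae_exists_mem_cell {m : ℕ} (hm : 0 < m) : ∀ᵐ x : I, ∃ i, x ∈ cell m i := by
  have h1 : ∀ᵐ x : I, x ≠ 1 := by simp [ae_iff]
  filter_upwards [h1] with x hx using exists_mem_cell hm hx

lemma memLp_step {m : ℕ} (Y : Fin m → ℝ) (p : ℝ≥0∞) : MemLp (step Y) p := by
  refine memLp_finsetSum Finset.univ (f := fun i => (cell m i).indicator fun _ => Y i) fun i _ => ?_
  exact (memLp_const (Y i)).indicator (measurableSet_cell m i)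

lemma integral_step_mul {m : ℕ} (Y : Fin m → ℝ) {e : I → ℝ} (he : Integrable e) :
    ∫ x, step Y x * e x = ∑ i, Y i * ∫ x in cell m i, e x := by
  have h : ∀ i x, (cell m i).indicator (fun _ => Y i) x * e x =
      (cell m i).indicator (fun x => Y i * e x) x := fun i x => by
    by_cases hx : x ∈ cell m i <;> simp [hx]
  simp_rw [step_eq_sum, Finset.sum_mul, h]
  rw [integral_finsetSum _ fun i _ => (he.const_mul (Y i)).indicator (measurableSet_cell m i)]
  refine Finset.sum_congr rfl fun i _ => ?_
  rw [integral_indicator (measurableSet_cell m i), integral_const_mul]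

lemma integral_step_sq {m : ℕ} (Y : Fin m → ℝ) : ∫ x, step Y x ^ 2 = (∑ i, Y i ^ 2) / m := by
  simp_rw [sq (step Y _)]
  rw [integral_step_mul Y ((memLp_step Y 2).integrable one_le_two), Finset.sum_div]
  refine Finset.sum_congr rfl fun i _ => ?_
  rw [setIntegral_congr_fun (measurableSet_cell m i) (fun x hx => step_of_mem_cell Y hx),
    setIntegral_const, measureReal_cell, smul_eq_mul]
  ring

/-- Averaging over the cells does not increase the `L²` norm. -/
lemma mul_sum_sq_setIntegral_cell_le (m : ℕ) {e : I → ℝ} (he : MemLp e 2) :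
    m * ∑ i, (∫ x in cell m i, e x) ^ 2 ≤ ∫ x, e x ^ 2 := by
  rcases Nat.eq_zero_or_pos m with rfl | hm
  · simpa using integral_nonneg fun x => sq_nonneg (e x)
  have hm' : (m : ℝ) ≠ 0 := by exact_mod_cast hm.ne'
  -- The cell averages of `e`; expanding the squared distance from `e` to this step function gives
  -- the claim.
  set Y : Fin m → ℝ := fun i => m * ∫ x in cell m i, e x with hY
  have hs := memLp_step Y 2
  have h0 : 0 ≤ ∫ x, (e x - step Y x) ^ 2 := integral_nonneg fun x => sq_nonneg _
  have h1 : ∫ x, (e x - step Y x) ^ 2 =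
      (∫ x, e x ^ 2) - 2 * (∫ x, step Y x * e x) + ∫ x, step Y x ^ 2 := by
    have hse : Integrable fun x => step Y x * e x := hs.integrable_mul he
    have hd : Integrable fun x => e x ^ 2 - 2 * (step Y x * e x) :=
      he.integrable_sq.sub (hse.const_mul 2)
    rw [← integral_const_mul, ← integral_sub he.integrable_sq (hse.const_mul 2),
      ← integral_add hd hs.integrable_sq]
    congr 1 with x
    ring
  have h2 : ∑ i, Y i * ∫ x in cell m i, e x = m * ∑ i, (∫ x in cell m i, e x) ^ 2 := by
    rw [Finset.mul_sum]
    exact Finset.sum_congr rfl fun i _ => by rw [hY]; ring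
  have h3 : (∑ i, Y i ^ 2) / m = m * ∑ i, (∫ x in cell m i, e x) ^ 2 := by
    rw [Finset.mul_sum, Finset.sum_div]
    exact Finset.sum_congr rfl fun i _ => by rw [hY]; field_simp
  rw [h1, integral_step_mul Y (he.integrable one_le_two), integral_step_sq, h2, h3] at h0
  linarith

/-- The coefficient of `e` in the step function with values `z`, as a linear function of `z`. -/
def noiseCoeff (m : ℕ) (e : I → ℝ) : (Fin m → ℝ) →ₗ[ℝ] ℝ :=
  ∑ i, (∫ x in cell m i, e x) • LinearMap.proj i

lemma noiseCoeff_apply {m : ℕ} (e : I → ℝ) (z : Fin m → ℝ) :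
    noiseCoeff m e z = ∑ i, z i * ∫ x in cell m i, e x := by
  simp [noiseCoeff, mul_comm]

/-- The argument of the threshold is a linear function of the noise plus a deterministic
coefficient. Measurability and the small-noise estimate both use this form. -/
lemma coeff_add (sd : ℝ≥0) {m : ℕ} (Y z : Fin m → ℝ) {e : I → ℝ} (he : Integrable e) :
    coeff sd (fun i => Y i + z i) e =
      soft (threshold sd m) (noiseCoeff m e z + ∫ x, step Y x * e x) := by
  rw [coeff, integral_step_mul _ he, integral_step_mul _ he, noiseCoeff_apply,
    ← Finset.sum_add_distrib]
  congr 1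
  exact Finset.sum_congr rfl fun i _ => by ring

/-! ### The reconstruction as a random combination of the basis -/

variable {φ ψ : ℝ → ℝ}

/-- The indices of the `2 ^ J` basis functions that are used at scale `J`. -/
def waveletIndices (J : ℕ) : Finset WaveletIndex :=
  Finset.insertNone ((Finset.range J).sigma fun _ => Finset.univ)

lemma sum_waveletIndices (J : ℕ) (f : WaveletIndex → ℝ) :
    ∑ e ∈ waveletIndices J, f e =
      f none + ∑ j ∈ Finset.range J, ∑ k : Fin (2 ^ j), f (some ⟨j, k⟩) := by
  rw [waveletIndices, Finset.sum_insertNone, Finset.sum_sigma]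

lemma card_waveletIndices (J : ℕ) : (waveletIndices J).card = 2 ^ J := by
  have h := Nat.geomSum_eq (le_refl 2) J
  rw [waveletIndices, Finset.card_insertNone, Finset.card_sigma]
  simp only [Finset.card_univ, Fintype.card_fin]
  rw [h]
  have := Nat.one_le_two_pow (n := J)
  omega

lemma tendsto_waveletIndices : Tendsto waveletIndices atTop atTop := by
  refine tendsto_atTop_finset_of_monotone ?_ ?_
  · intro J J' h
    exact Finset.insertNone.monotone (Finset.sigma_mono (Finset.range_mono h) fun _ => le_rfl)
  · rintro (_ | ⟨j, k⟩)
    · exact ⟨0, Finset.none_mem_insertNone⟩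
    · exact ⟨j + 1, by simp [waveletIndices]⟩

lemma reconstruct_eq_sum (φ ψ : ℝ → ℝ) (sd : ℝ≥0) (J : ℕ) (Y : Fin (2 ^ J) → ℝ) (x : I) :
    reconstruct φ ψ sd J Y x = ∑ e ∈ waveletIndices J,
      coeff sd Y (periodicWavelet φ ψ e) * periodicWavelet φ ψ e x := by
  rw [sum_waveletIndices, reconstruct]
  congr 1
  refine Finset.sum_congr rfl fun j _ => ?_
  rw [Finset.sum_range]
  rfl

lemma IsWavelet.integrable_periodicWavelet (hw : IsWavelet φ ψ) (e : WaveletIndex) :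
    Integrable (periodicWavelet φ ψ e) :=
  (hw.memLp_periodicWavelet e).integrable one_le_two

lemma IsWavelet.memLp_reconstruct (hw : IsWavelet φ ψ) (sd : ℝ≥0) (J : ℕ)
    (Y : Fin (2 ^ J) → ℝ) : MemLp (reconstruct φ ψ sd J Y) 2 := by
  rw [funext (reconstruct_eq_sum φ ψ sd J Y)]
  exact memLp_finsetSum _ fun e _ => (hw.memLp_periodicWavelet e).const_mul _

lemma IsWavelet.energy_reconstruct (hw : IsWavelet φ ψ) (sd : ℝ≥0) (J : ℕ) (Y : Fin (2 ^ J) → ℝ)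
    {cmax : ℝ} {p : I → ℝ} (hp : p ∈ Admissible cmax) :
    energy (reconstruct φ ψ sd J Y) p = ∑ e ∈ waveletIndices J,
      coeff sd Y (periodicWavelet φ ψ e) * energy (periodicWavelet φ ψ e) p := by
  simp_rw [energy_eq_integral_mul hp, reconstruct_eq_sum, Finset.mul_sum]
  rw [integral_finsetSum]
  · refine Finset.sum_congr rfl fun e _ => ?_
    rw [← integral_const_mul]
    congr 1 with x
    ring
  · exact fun e _ => integrable_mul_of_mem_admissible hp
      ((hw.integrable_periodicWavelet e).const_mul _)

lemma threshold_nonneg (sd : ℝ≥0) (m : ℕ) : 0 ≤ threshold sd m := Real.sqrt_nonneg _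

/-! ### The expected information loss is well defined -/

section Loss

variable {𝒴 : Type*} [MeasurableSpace 𝒴] (κ : Kernel I 𝒴) {cmax : ℝ}

/-- For fixed `p` the delivered energy is a linear combination of the thresholded coefficients, so
the feasible set has the form treated in `aemeasurable_biSup_soft`. -/
lemma IsWavelet.aemeasurable_capacity_reconstruct (hw : IsWavelet φ ψ) {sd : ℝ≥0} (hsd : 0 < sd)
    (J : ℕ) (Y : Fin (2 ^ J) → ℝ) (B : ℝ) :
    AEMeasurable (fun z => capacity κ cmax (reconstruct φ ψ sd J fun i => Y i + z i) B)
      (noise sd (2 ^ J)) := by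
  have h := aemeasurable_biSup_soft (ι := waveletIndices J)
    (fun e => noiseCoeff (2 ^ J) (periodicWavelet φ ψ e))
    (fun e => ∫ x, step Y x * periodicWavelet φ ψ e x) (threshold_nonneg sd (2 ^ J))
    (Admissible cmax) (fun p => mutualInfo κ (inputLaw p))
    (fun p e => energy (periodicWavelet φ ψ e) p) B (noise_absolutelyContinuous hsd (2 ^ J))
  refine h.congr (.of_forall fun z => ?_)
  have hset : {p | p ∈ Admissible cmax ∧ B ≤ ∑ e : waveletIndices J, soft (threshold sd (2 ^ J))
      (noiseCoeff (2 ^ J) (periodicWavelet φ ψ e) z + ∫ x, step Y x * periodicWavelet φ ψ e x) *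
        energy (periodicWavelet φ ψ e) p} =
      {p | p ∈ Admissible cmax ∧ B ≤ energy (reconstruct φ ψ sd J fun i => Y i + z i) p} := by
    ext p
    refine and_congr_right fun hp => ?_
    rw [hw.energy_reconstruct sd J _ hp]
    simp_rw [coeff_add sd Y z (hw.integrable_periodicWavelet _)]
    exact iff_of_eq (congrArg _ (Finset.sum_coe_sort (waveletIndices J) fun e =>
      soft (threshold sd (2 ^ J)) (noiseCoeff (2 ^ J) (periodicWavelet φ ψ e) z +
        ∫ x, step Y x * periodicWavelet φ ψ e x) * energy (periodicWavelet φ ψ e) p))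
  simp only [capacity]
  rw [← hset]

lemma abs_toReal_sub_toReal_le {a b M : ℝ≥0∞} (hM : M ≠ ∞) (ha : a ≤ M) (hb : b ≤ M) :
    |a.toReal - b.toReal| ≤ M.toReal := by
  have h1 := ENNReal.toReal_mono hM ha
  have h2 := ENNReal.toReal_mono hM hb
  have h3 := ENNReal.toReal_nonneg (a := a)
  have h4 := ENNReal.toReal_nonneg (a := b)
  exact abs_le.2 ⟨by linarith, by linarith⟩

lemma infoLoss_nonneg (sd : ℝ≥0) (x : ∀ m : ℕ, Fin m → I) (β : I → ℝ) (B : ℝ) (J : ℕ)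
    (z : Fin (2 ^ J) → ℝ) : 0 ≤ infoLoss κ cmax φ ψ sd x β B J z := abs_nonneg _

lemma infoLoss_le (hC : maxCapacity κ cmax ≠ ∞) (sd : ℝ≥0) (x : ∀ m : ℕ, Fin m → I) (β : I → ℝ)
    (B : ℝ) (J : ℕ) (z : Fin (2 ^ J) → ℝ) :
    infoLoss κ cmax φ ψ sd x β B J z ≤ (maxCapacity κ cmax).toReal :=
  abs_toReal_sub_toReal_le hC (capacity_le_maxCapacity κ _ _ _) (capacity_le_maxCapacity κ _ _ _)

lemma IsWavelet.integrable_infoLoss (hw : IsWavelet φ ψ) (hC : maxCapacity κ cmax ≠ ∞)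
    {sd : ℝ≥0} (hsd : 0 < sd) (x : ∀ m : ℕ, Fin m → I) (β : I → ℝ) (B : ℝ) (J : ℕ) :
    Integrable (infoLoss κ cmax φ ψ sd x β B J) (noise sd (2 ^ J)) := by
  refine Integrable.of_bound ?_ (maxCapacity κ cmax).toReal (.of_forall fun z => ?_)
  · exact (aemeasurable_const.sub
      (hw.aemeasurable_capacity_reconstruct κ hsd J _ B).ennreal_toReal).abs.aestronglyMeasurable
  · rw [Real.norm_eq_abs, abs_of_nonneg (infoLoss_nonneg κ sd x β B J z)]
    exact infoLoss_le κ hC sd x β B J z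

end Loss

end SIET

end

noncomputable section

namespace SIET

/-! ### Gaussian tails -/

lemma integral_Ioi_mul_exp (t : ℝ) :
    ∫ x in Set.Ioi t, x * Real.exp (-x ^ 2 / 2) = Real.exp (-t ^ 2 / 2) := by
  have hd : ∀ x : ℝ, HasDerivAt (fun x => -Real.exp (-x ^ 2 / 2)) (x * Real.exp (-x ^ 2 / 2)) x := by
    intro x
    have h1 : HasDerivAt (fun x : ℝ => -x ^ 2 / 2) (-x) x := by
      have := ((hasDerivAt_pow 2 x).neg).div_const 2
      refine this.congr_deriv ?_
      simp
      ring
    refine h1.exp.neg.congr_deriv ?_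
    ring
  have hint : Integrable fun x : ℝ => x * Real.exp (-x ^ 2 / 2) := by
    refine (integrable_mul_exp_neg_mul_sq (b := 1 / 2) (by norm_num)).congr
      (.of_forall fun x => ?_)
    simp only
    congr 2
    ring
  have hlim : Tendsto (fun x : ℝ => -Real.exp (-x ^ 2 / 2)) atTop (𝓝 0) := by
    rw [← neg_zero]
    refine (Real.tendsto_exp_atBot.comp ?_).neg
    have : Tendsto (fun x : ℝ => x ^ 2 / 2) atTop atTop :=
      (tendsto_pow_atTop two_ne_zero).atTop_div_const two_pos
    refine (tendsto_neg_atTop_atBot.comp this).congr fun x => ?_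
    simp only [Function.comp]
    ring
  rw [integral_Ioi_of_hasDerivAt_of_tendsto (hd t).continuousAt.continuousWithinAt
    (fun x _ => hd x) hint.integrableOn hlim]
  ring

/-- On the range of integration 1 ≤ x/t, and x exp(-x²/2) has an explicit primitive; √(2π) ≥ 2 gives
the constant. The factor 1/t is essential: without it the union bound at the chosen threshold would
not tend to 0. -/
lemma gaussianReal_Ioi_le {t : ℝ} (ht : 0 < t) :
    (gaussianReal 0 1).real (Set.Ioi t) ≤ Real.exp (-t ^ 2 / 2) / (2 * t) := by
  have hint : Integrable fun x : ℝ => x * Real.exp (-x ^ 2 / 2) := by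
    refine (integrable_mul_exp_neg_mul_sq (b := 1 / 2) (by norm_num)).congr
      (.of_forall fun x => ?_)
    simp only
    congr 2
    ring
  have h2 : (2 : ℝ) ≤ √(2 * Real.pi * (1 : ℝ≥0)) := by
    apply Real.le_sqrt_of_sq_le
    have := Real.pi_gt_three
    push_cast
    linarith
  rw [measureReal_def, gaussianReal_apply_eq_integral _ one_ne_zero, ENNReal.toReal_ofReal
    (setIntegral_nonneg measurableSet_Ioi fun x _ => gaussianPDFReal_nonneg _ _ _)]
  calc ∫ x in Set.Ioi t, gaussianPDFReal 0 1 x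
      ≤ ∫ x in Set.Ioi t, (2 * t)⁻¹ * (x * Real.exp (-x ^ 2 / 2)) := by
        refine setIntegral_mono_on (integrable_gaussianPDFReal 0 1).integrableOn
          (hint.const_mul _).integrableOn measurableSet_Ioi fun x hx => ?_
        have hx' : 0 < x := ht.trans hx
        rw [gaussianPDFReal_def]
        simp only [sub_zero, NNReal.coe_one, mul_one] at h2 ⊢
        rw [← mul_assoc]
        refine mul_le_mul_of_nonneg_right ?_ (Real.exp_pos _).le
        calc (√(2 * Real.pi))⁻¹ ≤ 2⁻¹ := inv_anti₀ two_pos h2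
          _ ≤ (2 * t)⁻¹ * x := by
            rw [mul_inv, mul_assoc]
            refine le_mul_of_one_le_right (by norm_num) ?_
            rw [inv_mul_eq_div, one_le_div ht]
            exact (Set.mem_Ioi.1 hx).le
    _ = Real.exp (-t ^ 2 / 2) / (2 * t) := by
        rw [integral_const_mul, integral_Ioi_mul_exp]
        ring

lemma gaussianReal_abs_ge_le {t : ℝ} (ht : 0 < t) :
    (gaussianReal 0 1).real {x | t ≤ |x|} ≤ Real.exp (-t ^ 2 / 2) / t := by
  have := nullSingletonClass_gaussianReal (μ := 0) (v := 1) one_ne_zero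
  have h1 : (gaussianReal 0 1).real (Set.Iic (-t)) = (gaussianReal 0 1).real (Set.Ici t) := by
    have h := gaussianReal_map_neg (μ := 0) (v := 1)
    rw [neg_zero] at h
    conv_lhs => rw [← h]
    rw [map_measureReal_apply measurable_neg measurableSet_Iic]
    congr 1
    ext x
    simp
  have h2 : (gaussianReal 0 1).real (Set.Ici t) = (gaussianReal 0 1).real (Set.Ioi t) :=
    measureReal_congr Ioi_ae_eq_Ici.symm
  have h3 : {x : ℝ | t ≤ |x|} = Set.Iic (-t) ∪ Set.Ici t := by
    ext x
    simp only [Set.mem_ofPred_eq, Set.mem_union, Set.mem_Iic, Set.mem_Ici, le_abs']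
  rw [h3]
  refine (measureReal_union_le _ _).trans ?_
  rw [h1, h2]
  have := gaussianReal_Ioi_le ht
  calc _ ≤ Real.exp (-t ^ 2 / 2) / (2 * t) + Real.exp (-t ^ 2 / 2) / (2 * t) := by linarith
    _ = _ := by field_simp; norm_num

/-! ### The empirical coefficients of the noise -/

lemma isGaussian_noise (sd : ℝ≥0) (m : ℕ) : IsGaussian (noise sd m) := by
  have h := iIndepFun.hasGaussianLaw (P := noise sd m) (X := fun i (z : Fin m → ℝ) => z i)
    (fun i => ⟨by
      rw [noise, (measurePreserving_eval (fun _ : Fin m => gaussianReal 0 (sd ^ 2)) i).map_eq]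
      infer_instance⟩)
    (iIndepFun_pi (X := fun _ x => x) fun i => aemeasurable_id)
  have h' := h.isGaussian_map
  have : (fun (ω : Fin m → ℝ) x => ω x) = id := rfl
  rwa [this, Measure.map_id] at h'

lemma map_noiseCoeff (sd : ℝ≥0) (m : ℕ) (e : I → ℝ) :
    (noise sd m).map (noiseCoeff m e) =
      gaussianReal 0 (sd ^ 2 * ∑ i, (∫ x in cell m i, e x) ^ 2 : ℝ).toNNReal := by
  have := isGaussian_noise sd m
  set L : StrongDual ℝ (Fin m → ℝ) := LinearMap.toContinuousLinearMap (noiseCoeff m e) with hL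
  have hLz : ∀ z, L z = ∑ i, (∫ x in cell m i, e x) * z i := fun z => by
    simp only [hL, LinearMap.coe_toContinuousLinearMap', noiseCoeff_apply, mul_comm]
  have h := IsGaussian.map_eq_gaussianReal (μ := noise sd m) L
  have hmem : ∀ i : Fin m, MemLp (fun x : ℝ => (∫ x in cell m i, e x) * x) 2
      (gaussianReal 0 (sd ^ 2)) := fun i =>
    (memLp_id_gaussianReal 2).const_mul (∫ x in cell m i, e x)
  have hmean : ∫ z, L z ∂(noise sd m) = 0 := by
    simp_rw [hLz]
    rw [integral_finsetSum]
    · refine Finset.sum_eq_zero fun i _ => ?_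
      rw [integral_const_mul]
      have := integral_comp_eval (μ := fun _ : Fin m => gaussianReal 0 (sd ^ 2)) (i := i)
        (f := fun x : ℝ => x) aestronglyMeasurable_id
      rw [noise, this, integral_id_gaussianReal, mul_zero]
    · intro i _
      have := (measurePreserving_eval (fun _ : Fin m => gaussianReal 0 (sd ^ 2)) i).integrable_comp
        (hmem i).1
      exact this.2 ((hmem i).integrable one_le_two)
  have hvar : Var[L; noise sd m] = sd ^ 2 * ∑ i, (∫ x in cell m i, e x) ^ 2 := by
    have hsum : (L : (Fin m → ℝ) → ℝ) =
        ∑ i, fun z : Fin m → ℝ => (fun x : ℝ => (∫ x in cell m i, e x) * x) (z i) := by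
      ext z
      rw [hLz, Finset.sum_apply]
    rw [hsum, noise, variance_sum_pi hmem, Finset.mul_sum]
    refine Finset.sum_congr rfl fun i _ => ?_
    rw [variance_const_mul]
    have : Var[fun x : ℝ => x; gaussianReal 0 (sd ^ 2)] = _ := variance_id_gaussianReal
    rw [this]
    push_cast
    ring
  rw [hmean, hvar] at h
  exact h

lemma threshold_eq (sd : ℝ≥0) (m : ℕ) :
    threshold sd m = sd / √m * √(2 * Real.log m) := by
  rw [threshold, show 2 * ((sd : ℝ) ^ 2 / m) * Real.log m = (sd : ℝ) ^ 2 / m * (2 * Real.log m) by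
    ring, Real.sqrt_mul (by positivity), Real.sqrt_div (by positivity), Real.sqrt_sq (NNReal.coe_nonneg sd)]

/-- The coefficient is centred Gaussian of variance at most sd²/m, since averaging over cells does
not increase the norm of `e`. The threshold is therefore at least √(2 log m) standard deviations. -/
lemma noise_abs_noiseCoeff_ge_le {sd : ℝ≥0} (hsd : 0 < sd) {m : ℕ} (hm : 1 < m) {e : I → ℝ}
    (he : MemLp e 2) (he1 : ∫ x, e x ^ 2 ≤ 1) :
    (noise sd m).real {z | threshold sd m ≤ |noiseCoeff m e z|} ≤
      1 / (m * √(2 * Real.log m)) := by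
  have hm0 : (0 : ℝ) < m := by positivity
  have hlog : 0 < Real.log m := Real.log_pos (by exact_mod_cast hm)
  set t := √(2 * Real.log m) with ht
  have ht0 : 0 < t := Real.sqrt_pos.2 (by positivity)
  set v : ℝ := sd ^ 2 * ∑ i, (∫ x in cell m i, e x) ^ 2 with hv
  have hv0 : 0 ≤ v := mul_nonneg (by positivity) (Finset.sum_nonneg fun i _ => sq_nonneg _)
  have hv1 : √v ≤ sd / √m := by
    rw [← Real.sqrt_sq (NNReal.coe_nonneg sd), ← Real.sqrt_div (sq_nonneg _)]
    refine Real.sqrt_le_sqrt ?_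
    rw [hv, le_div_iff₀ hm0, mul_assoc]
    refine mul_le_of_le_one_right (by positivity) ?_
    rw [mul_comm]
    exact (mul_sum_sq_setIntegral_cell_le m he).trans he1
  have hmeas : MeasurableSet {x : ℝ | threshold sd m ≤ |x|} :=
    measurableSet_le measurable_const measurable_id.abs
  have hL : Measurable (noiseCoeff m e) :=
    (LinearMap.toContinuousLinearMap (noiseCoeff m e)).continuous.measurable
  -- Rescaling the standard Gaussian includes the degenerate case v = 0.
  have hscale : gaussianReal 0 v.toNNReal = (gaussianReal 0 1).map (fun x => √v * x) := by
    rw [gaussianReal_map_const_mul]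
    congr 1
    · simp
    · ext
      simp [Real.sq_sqrt hv0, hv0]
  have h1 : (noise sd m).real {z | threshold sd m ≤ |noiseCoeff m e z|} =
      (gaussianReal 0 1).real {x | threshold sd m ≤ |√v * x|} := by
    have : {z | threshold sd m ≤ |noiseCoeff m e z|} =
      noiseCoeff m e ⁻¹' {x : ℝ | threshold sd m ≤ |x|} := rfl
    rw [this, ← map_measureReal_apply hL hmeas, map_noiseCoeff, hscale,
      map_measureReal_apply (measurable_const_mul _) hmeas]
    rfl
  rw [h1]
  calc _ ≤ (gaussianReal 0 1).real {x | t ≤ |x|} := by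
        refine measureReal_mono fun x hx => ?_
        have hx : threshold sd m ≤ |√v * x| := hx
        rw [threshold_eq, abs_mul, abs_of_nonneg (Real.sqrt_nonneg v)] at hx
        have hc : 0 < (sd : ℝ) / √m := div_pos hsd (Real.sqrt_pos.2 hm0)
        exact le_of_mul_le_mul_left
          (hx.trans (mul_le_mul_of_nonneg_right hv1 (abs_nonneg x))) hc
    _ ≤ Real.exp (-t ^ 2 / 2) / t := gaussianReal_abs_ge_le ht0
    _ = 1 / (m * t) := by
        rw [ht, Real.sq_sqrt (by positivity), show -(2 * Real.log m) / 2 = -Real.log m by ring,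
          Real.exp_neg, Real.exp_log hm0, ← ht]
        field_simp

variable {φ ψ : ℝ → ℝ}

/-- The event that all empirical noise coefficients are below the threshold. -/
def smallNoise (φ ψ : ℝ → ℝ) (sd : ℝ≥0) (J : ℕ) : Set (Fin (2 ^ J) → ℝ) :=
  {z | ∀ e ∈ waveletIndices J,
    |noiseCoeff (2 ^ J) (periodicWavelet φ ψ e) z| < threshold sd (2 ^ J)}

lemma measurableSet_smallNoise (φ ψ : ℝ → ℝ) (sd : ℝ≥0) (J : ℕ) :
    MeasurableSet (smallNoise φ ψ sd J) := by
  have : smallNoise φ ψ sd J = ⋂ e ∈ waveletIndices J,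
      {z | |noiseCoeff (2 ^ J) (periodicWavelet φ ψ e) z| < threshold sd (2 ^ J)} := by
    ext z; simp [smallNoise]
  rw [this]
  refine Finset.measurableSet_biInter _ fun e _ => measurableSet_lt ?_ measurable_const
  exact (LinearMap.toContinuousLinearMap _).continuous.measurable.abs

/-- Union bound: the m coefficients cancel the factor 1/m of the individual tails, and 1/√(2 log m)
remains. -/
lemma IsWavelet.noise_compl_smallNoise_le (hw : IsWavelet φ ψ) {sd : ℝ≥0} (hsd : 0 < sd) {J : ℕ}
    (hJ : J ≠ 0) :
    (noise sd (2 ^ J)).real (smallNoise φ ψ sd J)ᶜ ≤ 1 / √(2 * Real.log (2 ^ J : ℕ)) := by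
  have h1 : (smallNoise φ ψ sd J)ᶜ = ⋃ e ∈ waveletIndices J,
      {z | threshold sd (2 ^ J) ≤ |noiseCoeff (2 ^ J) (periodicWavelet φ ψ e) z|} := by
    ext z; simp [smallNoise]
  rw [h1]
  refine (measureReal_biUnion_finset_le _ _).trans ((Finset.sum_le_sum fun e _ =>
    noise_abs_noiseCoeff_ge_le hsd (Nat.one_lt_two_pow hJ) (hw.memLp_periodicWavelet e) ?_).trans ?_)
  · have := hw.integral_periodicWavelet_mul e e
    rw [if_pos rfl] at this
    simp_rw [sq]
    exact this.le
  · rw [Finset.sum_const, card_waveletIndices, nsmul_eq_mul]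
    have : ((2 ^ J : ℕ) : ℝ) ≠ 0 := by positivity
    rw [mul_one_div, ← div_div, div_self this]

lemma IsWavelet.tendsto_noise_compl_smallNoise (hw : IsWavelet φ ψ) {sd : ℝ≥0} (hsd : 0 < sd) :
    Tendsto (fun J => (noise sd (2 ^ J)).real (smallNoise φ ψ sd J)ᶜ) atTop (𝓝 0) := by
  have h1 : Tendsto (fun J : ℕ => ((2 ^ J : ℕ) : ℝ)) atTop atTop :=
    tendsto_natCast_atTop_atTop.comp (tendsto_pow_atTop_atTop_of_one_lt one_lt_two)
  have h2 : Tendsto (fun J : ℕ => 1 / √(2 * Real.log (2 ^ J : ℕ))) atTop (𝓝 0) :=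
    tendsto_const_nhds.div_atTop (Real.tendsto_sqrt_atTop.comp
      ((Real.tendsto_log_atTop.comp h1).const_mul_atTop two_pos))
  refine squeeze_zero' (.of_forall fun J => measureReal_nonneg) ?_ h2
  filter_upwards [eventually_ne_atTop 0] with J hJ using hw.noise_compl_smallNoise_le hsd hJ

lemma tendsto_threshold (sd : ℝ≥0) : Tendsto (threshold sd) atTop (𝓝 0) := by
  have h1 : Tendsto (fun x : ℝ => Real.log x / x) atTop (𝓝 0) := by
    simpa using Real.isLittleO_log_id_atTop.tendsto_div_nhds_zero
  have h2 : Tendsto (fun m : ℕ => 2 * (sd : ℝ) ^ 2 * (Real.log m / m)) atTop (𝓝 0) := by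
    simpa using (h1.comp tendsto_natCast_atTop_atTop).const_mul (2 * (sd : ℝ) ^ 2)
  have h3 := (Real.continuous_sqrt.tendsto 0).comp h2
  rw [Real.sqrt_zero] at h3
  refine h3.congr fun m => ?_
  simp only [Function.comp, threshold]
  congr 1
  ring

end SIET

end

noncomputable section

namespace SIET

/-! ### Sampling a function of bounded variation -/

/-- The property shared by both grids: the i-th sample point lies in the closed i-th cell. -/
lemma grid_mem_Icc {x : ∀ m : ℕ, Fin m → I} (hx : x = regularGrid ∨ x = dyadicGrid) (m : ℕ)
    (i : Fin m) : (x m i : ℝ) ∈ Set.Icc ((i : ℝ) / m) (((i : ℝ) + 1) / m) := by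
  have hm := cast_pos_of_fin i
  have hi : (i : ℝ) + 1 ≤ m := by exact_mod_cast i.isLt
  have hi0 : (0 : ℝ) ≤ i := Nat.cast_nonneg _
  rcases hx with rfl | rfl
  · change (i : ℝ) / ((m : ℝ) - 1) ∈ _
    -- For m = 1 the regular grid reads 0/0, which is 0.
    rcases (show (0 : ℝ) ≤ (m : ℝ) - 1 by linarith).eq_or_lt with h | h
    · have : (i : ℝ) = 0 := by linarith
      rw [this]
      simp
    · constructor
      · exact div_le_div_of_nonneg_left hi0 h (by linarith)
      · rw [div_le_div_iff₀ h hm]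
        nlinarith
  · change (i : ℝ) / (m : ℝ) ∈ _
    exact ⟨le_rfl, (div_le_div_iff_of_pos_right hm).2 (by linarith)⟩

/-- The end points of the cells, as points of the unit interval. -/
def node (m i : ℕ) : I := Set.projIcc 0 1 zero_le_one ((i : ℝ) / m)

lemma monotone_node (m : ℕ) : Monotone (node m) := fun i j h =>
  Set.monotone_projIcc _ (div_le_div_of_nonneg_right (by exact_mod_cast h) (Nat.cast_nonneg _))

lemma mem_Icc_node {m : ℕ} {i : Fin m} {t : I}
    (ht : (t : ℝ) ∈ Set.Icc ((i : ℝ) / m) (((i : ℝ) + 1) / m)) :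
    t ∈ Set.Icc (node m i) (node m (i + 1)) := by
  constructor
  · have := Set.monotone_projIcc (zero_le_one' ℝ) ht.1
    rwa [Set.projIcc_val] at this
  · have := Set.monotone_projIcc (zero_le_one' ℝ) ht.2
    rw [Set.projIcc_val] at this
    rw [node]
    push_cast
    exact this

/-- The variation of `β` over the `i`-th closed cell. -/
def cellVariation (β : I → ℝ) (m : ℕ) (i : Fin m) : ℝ :=
  (eVariationOn β (Set.Icc (node m i) (node m (i + 1)))).toReal

variable {K : ℝ≥0} {β : I → ℝ}

lemma BV.sum_cellVariation_le (hβ : β ∈ BV K) (m : ℕ) : ∑ i, cellVariation β m i ≤ K := by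
  have h := eVariationOn.sum' β (monotone_node m) (n := m)
  have hfin : ∀ i ∈ Finset.range m,
      eVariationOn β (Set.Icc (node m i) (node m (i + 1))) ≠ ∞ := fun i _ =>
    ((BV.boundedVariationOn hβ).mono (Set.subset_univ _))
  have h1 : ∑ i, cellVariation β m i =
      (∑ i ∈ Finset.range m, eVariationOn β (Set.Icc (node m i) (node m (i + 1)))).toReal := by
    rw [ENNReal.toReal_sum hfin, Finset.sum_range]
    rfl
  rw [h1, h]
  exact ENNReal.toReal_le_coe_of_le_coe ((eVariationOn.mono β (Set.subset_univ _)).trans hβ)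

lemma BV.abs_sub_le_cellVariation (hβ : β ∈ BV K) {m : ℕ} {i : Fin m} {s t : I}
    (hs : s ∈ Set.Icc (node m i) (node m (i + 1))) (ht : t ∈ Set.Icc (node m i) (node m (i + 1))) :
    |β s - β t| ≤ cellVariation β m i := by
  rw [← Real.dist_eq]
  exact ((BV.boundedVariationOn hβ).mono (Set.subset_univ _)).dist_le hs ht

/-- On a cell one factor of the squared error is bounded by `K` and the other by the variation over
the cell. The variations sum to at most `K`, and each cell has length 1/m. -/
lemma BV.integral_step_sub_sq_le (hβ : β ∈ BV K) {x : ∀ m : ℕ, Fin m → I}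
    (hx : x = regularGrid ∨ x = dyadicGrid) {m : ℕ} (hm : 0 < m) :
    ∫ t, (step (fun i => β (x m i)) t - β t) ^ 2 ≤ K ^ 2 / m := by
  have hm' : (0 : ℝ) < m := by exact_mod_cast hm
  have h1 : ∫ t, (step (fun i => β (x m i)) t - β t) ^ 2 ≤
      ∫ t, step (fun i => K * cellVariation β m i) t := by
    refine integral_mono_ae ((memLp_step _ 2).sub (BV.memLp hβ 2)).integrable_sq
      ((memLp_step _ 2).integrable one_le_two) ?_
    filter_upwards [ae_exists_mem_cell hm] with t ⟨i, hi⟩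
    rw [step_of_mem_cell _ hi, step_of_mem_cell _ hi]
    have h2 := BV.abs_sub_le_cellVariation hβ (mem_Icc_node (grid_mem_Icc hx m i))
      (mem_Icc_node ⟨hi.1, hi.2.le⟩)
    have h3 := BV.abs_sub_le hβ (x m i) t
    rw [← sq_abs, sq]
    exact mul_le_mul h3 h2 (abs_nonneg _) K.2
  have h4 := integral_step_mul (fun i => K * cellVariation β m i) (integrable_const (1 : ℝ))
  simp only [mul_one, setIntegral_const, measureReal_cell, smul_eq_mul] at h4
  rw [h4, ← Finset.sum_mul, ← Finset.mul_sum] at h1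
  refine h1.trans ?_
  rw [mul_one_div, sq]
  exact div_le_div_of_nonneg_right
    (mul_le_mul_of_nonneg_left (BV.sum_cellVariation_le hβ m) K.2) hm'.le

/-! ### Error of soft thresholding -/

/-- When the noise is below the threshold, the estimate lies between 0 and `a`, and noise and
threshold together move it by at most 2t. -/
lemma abs_soft_sub_le {t n a : ℝ} (hn : |n| ≤ t) :
    |soft t (n + a) - a| ≤ |a| ∧ |soft t (n + a) - a| ≤ 2 * t := by
  have ht : 0 ≤ t := (abs_nonneg n).trans hn
  obtain ⟨hn1, hn2⟩ := abs_le.1 hn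
  rcases le_or_gt |n + a| t with h | h
  · rw [soft_of_abs_le h, zero_sub, abs_neg]
    obtain ⟨h1, h2⟩ := abs_le.1 h
    exact ⟨le_rfl, abs_le.2 ⟨by linarith, by linarith⟩⟩
  rcases lt_abs.1 h with h | h
  · rw [soft_of_lt ht h, show n + a - t - a = n - t by ring, abs_of_nonpos (by linarith)]
    exact ⟨by linarith [le_abs_self a], by linarith⟩
  · rw [soft_of_lt_neg ht (by linarith), show n + a + t - a = n + t by ring,
      abs_of_nonneg (by linarith)]
    exact ⟨by linarith [neg_le_abs a], by linarith⟩

/-- Here `θ` is the true coefficient and `a` that of the sampled step function. The two terms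
separate the thresholding error, summed by dominated convergence, from the sampling error, summed by
Bessel's inequality. -/
lemma sq_soft_sub_le {t n a θ : ℝ} (hn : |n| ≤ t) :
    (soft t (n + a) - θ) ^ 2 ≤ 4 * min (θ ^ 2) (4 * t ^ 2) + 6 * (a - θ) ^ 2 := by
  obtain ⟨h1, h2⟩ := abs_soft_sub_le (a := a) hn
  set d := soft t (n + a) - a with hd
  have e1 : d ^ 2 ≤ a ^ 2 := sq_le_sq.2 h1
  have e2 : d ^ 2 ≤ 4 * t ^ 2 := by
    have := sq_le_sq' (by linarith [abs_nonneg d]) h2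
    rw [sq_abs] at this
    linarith
  have e3 : (soft t (n + a) - θ) ^ 2 ≤ 2 * d ^ 2 + 2 * (a - θ) ^ 2 := by
    have : soft t (n + a) - θ = d + (a - θ) := by rw [hd]; ring
    rw [this]
    nlinarith [sq_nonneg (d - (a - θ))]
  have e4 : d ^ 2 ≤ 2 * min (θ ^ 2) (4 * t ^ 2) + 2 * (a - θ) ^ 2 := by
    rcases le_total (θ ^ 2) (4 * t ^ 2) with h | h
    · rw [min_eq_left h]
      nlinarith [sq_nonneg (a - 2 * θ)]
    · rw [min_eq_right h]
      nlinarith [sq_nonneg (a - θ), sq_nonneg t]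
  linarith

lemma integral_abs_le_sqrt {f : I → ℝ} (hf : MemLp f 2) : ∫ x, |f x| ≤ √(∫ x, f x ^ 2) := by
  have ha : Integrable fun x => |f x| := (hf.integrable one_le_two).abs
  set c := ∫ x, |f x| with hc
  have h0 : 0 ≤ ∫ x, (|f x| - c) ^ 2 := integral_nonneg fun x => sq_nonneg _
  have h1 : ∫ x, (|f x| - c) ^ 2 = (∫ x, f x ^ 2) - 2 * c * c + c ^ 2 := by
    have hd : Integrable fun x => f x ^ 2 - 2 * c * |f x| := hf.integrable_sq.sub (ha.const_mul _)
    have e : ∀ x, (|f x| - c) ^ 2 = (f x ^ 2 - 2 * c * |f x|) + c ^ 2 := fun x => by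
      rw [← sq_abs (f x)]; ring
    simp_rw [e]
    rw [integral_add hd (integrable_const _), integral_sub hf.integrable_sq (ha.const_mul _),
      integral_const_mul, ← hc]
    simp
  refine Real.le_sqrt_of_sq_le ?_
  rw [h1] at h0
  linarith

/-! ### Consistency of the reconstruction when the noise is small -/

variable {φ ψ : ℝ → ℝ}

/-- The coefficients of `β` in the periodized wavelet basis. -/
def waveletCoeff (φ ψ : ℝ → ℝ) (β : I → ℝ) (e : WaveletIndex) : ℝ :=
  ∫ x, β x * periodicWavelet φ ψ e x

lemma IsWavelet.inner_waveletLp (hw : IsWavelet φ ψ) {β : I → ℝ} (hβ : MemLp β 2)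
    (e : WaveletIndex) : inner ℝ (hw.waveletLp e) hβ.toLp = waveletCoeff φ ψ β e := by
  rw [real_inner_comm, IsWavelet.waveletLp, inner_toLp]
  rfl

/-- The energy of the coefficients of `β` at the level of the threshold. -/
def truncatedEnergy (φ ψ : ℝ → ℝ) (β : I → ℝ) (t : ℝ) : ℝ :=
  ∑' e, min (waveletCoeff φ ψ β e ^ 2) (4 * t ^ 2)

lemma IsWavelet.summable_waveletCoeff_sq (hw : IsWavelet φ ψ) {β : I → ℝ} (hβ : MemLp β 2) :
    Summable fun e => waveletCoeff φ ψ β e ^ 2 := by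
  refine (hw.orthonormal_waveletLp.inner_products_summable hβ.toLp).congr fun e => ?_
  rw [hw.inner_waveletLp hβ, Real.norm_eq_abs, sq_abs]

lemma IsWavelet.summable_truncated (hw : IsWavelet φ ψ) {β : I → ℝ} (hβ : MemLp β 2) (t : ℝ) :
    Summable fun e => min (waveletCoeff φ ψ β e ^ 2) (4 * t ^ 2) :=
  Summable.of_nonneg_of_le (fun e => le_min (sq_nonneg _) (by positivity))
    (fun e => min_le_left _ _) (hw.summable_waveletCoeff_sq hβ)

/-- Each term tends to 0 and is dominated by the summable squared coefficient, so square
integrability of `β` suffices and no decay rate of its coefficients is needed. -/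
lemma IsWavelet.tendsto_truncatedEnergy (hw : IsWavelet φ ψ) {β : I → ℝ} (hβ : MemLp β 2) :
    Tendsto (truncatedEnergy φ ψ β) (𝓝 0) (𝓝 0) := by
  have h : Tendsto (truncatedEnergy φ ψ β) (𝓝 0) (𝓝 (∑' _ : WaveletIndex, (0 : ℝ))) :=
    tendsto_tsum_of_dominated_convergence (𝓕 := 𝓝 (0 : ℝ))
    (f := fun t e => min (waveletCoeff φ ψ β e ^ 2) (4 * t ^ 2)) (g := fun _ => 0)
    (hw.summable_waveletCoeff_sq hβ) (fun e => ?_) (.of_forall fun t e => ?_)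
  · simpa using h
  · have : Continuous fun t : ℝ => min (waveletCoeff φ ψ β e ^ 2) (4 * t ^ 2) := by fun_prop
    have := this.tendsto 0
    simpa [sq_nonneg] using this
  · rw [Real.norm_eq_abs, abs_of_nonneg (le_min (sq_nonneg _) (by positivity))]
    exact min_le_left _ _

/-- The error of the projection of `β` to the first `2 ^ J` basis functions. -/
def IsWavelet.projectionError (hw : IsWavelet φ ψ) {β : I → ℝ} (hβ : MemLp β 2) (J : ℕ) : ℝ :=
  ‖∑ e ∈ waveletIndices J, waveletCoeff φ ψ β e • hw.waveletLp e - hβ.toLp‖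

lemma IsWavelet.tendsto_projectionError (hw : IsWavelet φ ψ) {β : I → ℝ} (hβ : MemLp β 2) :
    Tendsto (hw.projectionError hβ) atTop (𝓝 0) := by
  have h := (hw.hilbertBasis.hasSum_repr hβ.toLp).comp tendsto_waveletIndices
  rw [tendsto_iff_norm_sub_tendsto_zero] at h
  refine h.congr fun J => ?_
  simp only [Function.comp, IsWavelet.projectionError, HilbertBasis.repr_apply_apply,
    IsWavelet.hilbertBasis_apply, hw.inner_waveletLp hβ]

lemma IsWavelet.toLp_reconstruct (hw : IsWavelet φ ψ) (sd : ℝ≥0) (J : ℕ) (Y : Fin (2 ^ J) → ℝ) :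
    (hw.memLp_reconstruct sd J Y).toLp =
      ∑ e ∈ waveletIndices J, coeff sd Y (periodicWavelet φ ψ e) • hw.waveletLp e := by
  refine Lp.ext ((MemLp.coeFn_toLp _).trans ?_)
  have e3 := Lp.coeFn_finsetSum (waveletIndices J)
    fun e => coeff sd Y (periodicWavelet φ ψ e) • hw.waveletLp e
  have e4 : ∀ e, ⇑(coeff sd Y (periodicWavelet φ ψ e) • hw.waveletLp e) =ᵐ[volume]
      fun x => coeff sd Y (periodicWavelet φ ψ e) * periodicWavelet φ ψ e x := fun e =>
    (Lp.coeFn_smul _ _).trans ((MemLp.coeFn_toLp (hw.memLp_periodicWavelet e)).mono fun x hx => by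
      simp only [Pi.smul_apply, smul_eq_mul]; rw [← hx]; rfl)
  filter_upwards [e3, ae_all_iff.2 e4] with x h3 h4
  rw [h3, reconstruct_eq_sum]
  simp [h4]

lemma norm_sum_smul_sq_of_orthonormal {H ι : Type*} [NormedAddCommGroup H] [InnerProductSpace ℝ H]
    {b : ι → H} (hb : Orthonormal ℝ b) (s : Finset ι) (d : ι → ℝ) :
    ‖∑ i ∈ s, d i • b i‖ ^ 2 = ∑ i ∈ s, d i ^ 2 := by
  rw [← real_inner_self_eq_norm_sq, hb.inner_sum]
  simp [sq]

/-- A bound for the `L¹` error of the reconstruction at scale `J` when the noise is small. -/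
def IsWavelet.errorBound (hw : IsWavelet φ ψ) {β : I → ℝ} (hβ : MemLp β 2) (sd K : ℝ≥0) (J : ℕ) :
    ℝ :=
  √(4 * truncatedEnergy φ ψ β (threshold sd (2 ^ J)) + 6 * ((K : ℝ) ^ 2 / (2 ^ J : ℕ))) +
    hw.projectionError hβ J

lemma tendsto_natCast_two_pow : Tendsto (fun J : ℕ => ((2 ^ J : ℕ) : ℝ)) atTop atTop :=
  tendsto_natCast_atTop_atTop.comp (tendsto_pow_atTop_atTop_of_one_lt one_lt_two)

lemma IsWavelet.tendsto_errorBound (hw : IsWavelet φ ψ) {β : I → ℝ} (hβ : MemLp β 2)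
    (sd K : ℝ≥0) : Tendsto (hw.errorBound hβ sd K) atTop (𝓝 0) := by
  have h1 : Tendsto (fun J : ℕ => truncatedEnergy φ ψ β (threshold sd (2 ^ J))) atTop (𝓝 0) :=
    (hw.tendsto_truncatedEnergy hβ).comp
      ((tendsto_threshold sd).comp (tendsto_pow_atTop_atTop_of_one_lt one_lt_two))
  have h2 : Tendsto (fun J : ℕ => (K : ℝ) ^ 2 / (2 ^ J : ℕ)) atTop (𝓝 0) :=
    tendsto_const_nhds.div_atTop tendsto_natCast_two_pow
  have h3 := (Real.continuous_sqrt.tendsto _).comp ((h1.const_mul 4).add (h2.const_mul 6))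
  have h4 : Tendsto (hw.errorBound hβ sd K) atTop (𝓝 (√(4 * 0 + 6 * 0) + 0)) :=
    h3.add (hw.tendsto_projectionError hβ)
  simpa using h4

lemma IsWavelet.integral_abs_sub_reconstruct_le (hw : IsWavelet φ ψ) (hβ : β ∈ BV K)
    {x : ∀ m : ℕ, Fin m → I} (hx : x = regularGrid ∨ x = dyadicGrid) {sd : ℝ≥0} {J : ℕ}
    {z : Fin (2 ^ J) → ℝ} (hz : z ∈ smallNoise φ ψ sd J) :
    ∫ t, |β t - reconstruct φ ψ sd J (fun i => β (x (2 ^ J) i) + z i) t| ≤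
      hw.errorBound (BV.memLp hβ 2) sd K J := by
  have hβ2 := BV.memLp hβ 2
  set Y : Fin (2 ^ J) → ℝ := fun i => β (x (2 ^ J) i) with hY
  have hr := hw.memLp_reconstruct sd J fun i => Y i + z i
  have hsub : MemLp (fun t => β t - reconstruct φ ψ sd J (fun i => Y i + z i) t) 2 := hβ2.sub hr
  have hsubLp : hsub.toLp = hβ2.toLp - hr.toLp := rfl
  refine (integral_abs_le_sqrt hsub).trans ?_
  rw [← norm_toLp_sq hsub, Real.sqrt_sq (norm_nonneg _), hsubLp, norm_sub_rev,
    hw.toLp_reconstruct]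
  set c : WaveletIndex → ℝ := fun e => coeff sd (fun i => Y i + z i) (periodicWavelet φ ψ e)
  set θ : WaveletIndex → ℝ := waveletCoeff φ ψ β
  set S := waveletIndices J
  -- Coefficient error within the first 2^J basis functions, plus projection error.
  have hsplit : ∑ e ∈ S, c e • hw.waveletLp e - hβ2.toLp =
      ∑ e ∈ S, (c e - θ e) • hw.waveletLp e +
        (∑ e ∈ S, θ e • hw.waveletLp e - hβ2.toLp) := by
    simp_rw [sub_smul, Finset.sum_sub_distrib]
    abel
  rw [hsplit]
  refine (norm_add_le _ _).trans (add_le_add_left (Real.le_sqrt_of_sq_le ?_) _)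
  rw [norm_sum_smul_sq_of_orthonormal hw.orthonormal_waveletLp]
  have hs := memLp_step Y 2
  have hsβ : MemLp (fun t => step Y t - β t) 2 := hs.sub hβ2
  have hdiff : ∀ e, waveletCoeff φ ψ (step Y) e - θ e =
      inner ℝ (hw.waveletLp e) hsβ.toLp := by
    intro e
    rw [hw.inner_waveletLp hsβ]
    simp only [waveletCoeff, θ]
    have i1 : Integrable fun t => step Y t * periodicWavelet φ ψ e t :=
      hs.integrable_mul (hw.memLp_periodicWavelet e)
    have i2 : Integrable fun t => β t * periodicWavelet φ ψ e t :=
      hβ2.integrable_mul (hw.memLp_periodicWavelet e)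
    rw [← integral_sub i1 i2]
    congr 1 with t
    ring
  calc ∑ e ∈ S, (c e - θ e) ^ 2
      ≤ ∑ e ∈ S, (4 * min (θ e ^ 2) (4 * threshold sd (2 ^ J) ^ 2) +
          6 * (waveletCoeff φ ψ (step Y) e - θ e) ^ 2) := by
        refine Finset.sum_le_sum fun e he => ?_
        simp only [c]
        rw [coeff_add sd Y z (hw.integrable_periodicWavelet e)]
        exact sq_soft_sub_le (hz e he).le
    _ = 4 * ∑ e ∈ S, min (θ e ^ 2) (4 * threshold sd (2 ^ J) ^ 2) +
          6 * ∑ e ∈ S, ‖inner ℝ (hw.waveletLp e) hsβ.toLp‖ ^ 2 := by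
        rw [Finset.sum_add_distrib, Finset.mul_sum, Finset.mul_sum]
        simp_rw [hdiff, Real.norm_eq_abs, sq_abs]
    _ ≤ _ := by
        have h1 : ∑ e ∈ S, min (θ e ^ 2) (4 * threshold sd (2 ^ J) ^ 2) ≤
            truncatedEnergy φ ψ β (threshold sd (2 ^ J)) :=
          (hw.summable_truncated hβ2 _).sum_le_tsum S
            fun e _ => le_min (sq_nonneg _) (by positivity)
        have h2 : ∑ e ∈ S, ‖inner ℝ (hw.waveletLp e) hsβ.toLp‖ ^ 2 ≤ (K : ℝ) ^ 2 / (2 ^ J : ℕ) := by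
          refine (hw.orthonormal_waveletLp.sum_inner_products_le hsβ.toLp).trans ?_
          rw [norm_toLp_sq]
          exact BV.integral_step_sub_sq_le hβ hx (Nat.two_pow_pos J)
        linarith

end SIET

end

noncomputable section

namespace SIET

variable {φ ψ : ℝ → ℝ} {𝒴 : Type*} [MeasurableSpace 𝒴] (κ : Kernel I 𝒴) {cmax : ℝ}

/-! ### Convergence below the maximal energy -/

/-- If the loss is at most `η` on the event `A`, its expectation is at most `η` plus a multiple of
the probability of the complement of `A`. -/
lemma expectedInfoLoss_le (hw : IsWavelet φ ψ) (hC : maxCapacity κ cmax ≠ ∞) {sd : ℝ≥0}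
    (hsd : 0 < sd) (x : ∀ m : ℕ, Fin m → I) (β : I → ℝ) (B : ℝ) {J : ℕ}
    {A : Set (Fin (2 ^ J) → ℝ)} (hA : MeasurableSet A) {η : ℝ} (hη : 0 ≤ η)
    (h : ∀ z ∈ A, infoLoss κ cmax φ ψ sd x β B J z ≤ η) :
    expectedInfoLoss κ cmax φ ψ sd x β B J ≤
      η + (maxCapacity κ cmax).toReal * (noise sd (2 ^ J)).real Aᶜ := by
  have hi : Integrable (Aᶜ.indicator fun _ => (maxCapacity κ cmax).toReal) (noise sd (2 ^ J)) :=
    (integrable_const _).indicator hA.compl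
  calc expectedInfoLoss κ cmax φ ψ sd x β B J
      ≤ ∫ z, (η + Aᶜ.indicator (fun _ => (maxCapacity κ cmax).toReal) z)
          ∂(noise sd (2 ^ J)) := by
        refine integral_mono (hw.integrable_infoLoss κ hC hsd x β B J)
          ((integrable_const _).add hi) fun z => ?_
        by_cases hz : z ∈ A
        · simpa [hz] using h z hz
        · simpa [hz] using (infoLoss_le κ hC sd x β B J z).trans (le_add_of_nonneg_left hη)
    _ = _ := by
        rw [integral_add (integrable_const _) hi, integral_indicator_const _ hA.compl]
        simp [mul_comm]

lemma le_expectedInfoLoss (hw : IsWavelet φ ψ) (hC : maxCapacity κ cmax ≠ ∞) {sd : ℝ≥0}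
    (hsd : 0 < sd) (x : ∀ m : ℕ, Fin m → I) (β : I → ℝ) (B : ℝ) {J : ℕ}
    {A : Set (Fin (2 ^ J) → ℝ)} (hA : MeasurableSet A) {c : ℝ}
    (h : ∀ z ∈ A, c ≤ infoLoss κ cmax φ ψ sd x β B J z) :
    c * (noise sd (2 ^ J)).real A ≤ expectedInfoLoss κ cmax φ ψ sd x β B J := by
  calc c * (noise sd (2 ^ J)).real A = ∫ z, A.indicator (fun _ => c) z ∂(noise sd (2 ^ J)) := by
        rw [integral_indicator_const _ hA, smul_eq_mul, mul_comm]
    _ ≤ _ := by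
        refine integral_mono ((integrable_const _).indicator hA)
          (hw.integrable_infoLoss κ hC hsd x β B J) fun z => ?_
        by_cases hz : z ∈ A
        · simpa [hz] using h z hz
        · simpa [hz] using infoLoss_nonneg κ sd x β B J z

lemma tendsto_expectedInfoLoss [IsMarkovKernel κ] (hw : IsWavelet φ ψ)
    (hC : maxCapacity κ cmax ≠ ∞) {sd : ℝ≥0} (hsd : 0 < sd) {K : ℝ≥0}
    {x : ∀ m : ℕ, Fin m → I} (hx : x = regularGrid ∨ x = dyadicGrid) {β : I → ℝ} (hβ : β ∈ BV K)
    {B : ℝ} (hB0 : 0 ≤ B) (hB : B < maxEnergy cmax β) :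
    Tendsto (fun J => expectedInfoLoss κ cmax φ ψ sd x β B J) atTop (𝓝 0) := by
  obtain ⟨q, hq, hqB⟩ := exists_energy_gt hB0 hB
  have hcmax : 0 ≤ cmax := (hq.2.1 0).trans (hq.2.2.1 0)
  have hβ2 := BV.memLp hβ 2
  have hβi := hβ2.integrable one_le_two
  set C := (maxCapacity κ cmax).toReal with hCdef
  have hC0 : 0 ≤ C := ENNReal.toReal_nonneg
  have herr : Tendsto (fun J => cmax * hw.errorBound hβ2 sd K J) atTop (𝓝 0) := by
    simpa using (hw.tendsto_errorBound hβ2 sd K).const_mul cmax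
  have hbad : Tendsto (fun J => C * (noise sd (2 ^ J)).real (smallNoise φ ψ sd J)ᶜ) atTop (𝓝 0) := by
    simpa using (hw.tendsto_noise_compl_smallNoise hsd).const_mul C
  rw [Metric.tendsto_atTop']
  intro η hη
  -- The mixing weight is fixed before the scale: it makes the loss on the good event less than η/2,
  -- with C + 1 in the denominator because C may vanish. The reconstruction error then has to fall
  -- below the energy gained with this `t`.
  set t := min (1 / 2) (η / (2 * (C + 1))) with ht
  have ht0 : 0 < t := lt_min (by norm_num) (by positivity)
  have ht1 : t < 1 := (min_le_left _ _).trans_lt (by norm_num)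
  have htC : t * C < η / 2 := by
    have h1 : t * (2 * (C + 1)) ≤ η := (le_div_iff₀ (by positivity)).1 (min_le_right _ _)
    linarith
  have hgap : 0 < t * (energy β q - B) := mul_pos ht0 (sub_pos.2 hqB)
  obtain ⟨N, hN⟩ := eventually_atTop.1
    ((herr.eventually_le_const hgap).and (hbad.eventually_lt_const (half_pos hη)))
  refine ⟨N, fun J hJ => ?_⟩
  obtain ⟨h1, h2⟩ := hN J hJ.le
  have h3 := expectedInfoLoss_le κ hw hC hsd x β B (measurableSet_smallNoise φ ψ sd J)
    (mul_nonneg ht0.le hC0) fun z hz => by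
      refine abs_capacity_sub_le κ hC hβi hq ht0.le ht1 (fun p hp => ?_) h1
      exact (abs_energy_sub_le hp hβi ((hw.memLp_reconstruct sd J _).integrable one_le_two)).trans
        (mul_le_mul_of_nonneg_left (hw.integral_abs_sub_reconstruct_le hβ hx hz) hcmax)
  have h4 : 0 ≤ expectedInfoLoss κ cmax φ ψ sd x β B J :=
    integral_nonneg fun z => infoLoss_nonneg κ sd x β B J z
  rw [Real.dist_0_eq_abs, abs_of_nonneg h4]
  linarith

/-! ### Failure at the maximal energy -/

lemma const_mem_BV (c : ℝ) (K : ℝ≥0) : (fun _ : I => c) ∈ BV K := by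
  have : eVariationOn (fun _ : I => c) Set.univ = 0 :=
    eVariationOn.constant_on (by rintro _ ⟨_, _, rfl⟩ _ ⟨_, _, rfl⟩; rfl)
  rw [BV, Set.mem_ofPred_eq, this]
  exact zero_le

lemma energy_const {p : I → ℝ} (hp : p ∈ Admissible cmax) (c : ℝ) : energy (fun _ => c) p = c := by
  rw [energy_eq_integral_mul hp, integral_mul_const, hp.2.2.2, one_mul]

lemma maxEnergy_const (h : (Admissible cmax).Nonempty) (c : ℝ) :
    maxEnergy cmax (fun _ => c) = c := by
  have : energy (fun _ => c) '' Admissible cmax = {c} := by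
    ext y
    constructor
    · rintro ⟨p, hp, rfl⟩
      exact energy_const hp c
    · rintro rfl
      obtain ⟨p, hp⟩ := h
      exact ⟨p, hp, energy_const hp _⟩
  rw [maxEnergy, this, csSup_singleton]

lemma admissible_nonempty_of_maxCapacity_ne_zero (h : maxCapacity κ cmax ≠ 0) :
    (Admissible cmax).Nonempty := by
  by_contra h'
  rw [Set.not_nonempty_iff_eq_empty] at h'
  exact h (by simp [maxCapacity, h'])

lemma integral_dilate_eq_zero {f : ℝ → ℝ} (hf : ∫ x, f x = 0) (j k : ℤ) :
    ∫ x, dilate f j k x = 0 := by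
  simp only [dilate]
  rw [integral_const_mul, Measure.integral_comp_mul_left (fun x => f (x - k)),
    integral_sub_right_eq_self f (k : ℝ), hf]
  simp

lemma IsWavelet.integral_periodicWavelet_some (hw : IsWavelet φ ψ) (a : Σ j : ℕ, Fin (2 ^ j)) :
    ∫ x, periodicWavelet φ ψ (some a) x = 0 := by
  obtain ⟨M, hM⟩ := hw.exists_vanishesBeyond_mother a.1 (a.2 : ℕ)
  -- Square integrability gives integrability because the support is bounded.
  have hi : Integrable (dilate ψ a.1 (a.2 : ℕ)) := by
    have hsupp : Function.support (dilate ψ a.1 (a.2 : ℕ)) ⊆ Metric.closedBall 0 M := by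
      intro x hx
      rw [mem_closedBall_zero_iff, Real.norm_eq_abs]
      by_contra h
      exact hx (hM x (not_le.1 h))
    have : IsFiniteMeasure (volume.restrict (Metric.closedBall (0 : ℝ) M)) :=
      isFiniteMeasure_restrict.2 measure_closedBall_lt_top.ne
    rw [← integrableOn_iff_integrable_of_support_subset hsupp]
    exact ((memLp_dilate hw.memLp_mother _ _).restrict _).integrable one_le_two
  exact (hM.integral_periodize hi).trans (integral_dilate_eq_zero hw.vanishing_moment _ _)

/-- The periodized father wavelet is a constant of modulus `1`. -/
lemma IsWavelet.exists_periodicWavelet_none_ae_eq (hw : IsWavelet φ ψ) :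
    ∃ c : ℝ, (c = 1 ∨ c = -1) ∧ (∫ x, periodicWavelet φ ψ none x = c) ∧
      periodicWavelet φ ψ none =ᵐ[volume] fun _ => c := by
  set c := ∫ x, periodicWavelet φ ψ none x with hc
  have hnone := hw.memLp_periodicWavelet none
  -- All periodized mother wavelets have mean 0, so 1 minus its component along the father wavelet
  -- is orthogonal to the whole basis; completeness makes it vanish.
  have h1 : (fun x => 1 - c * periodicWavelet φ ψ none x) =ᵐ[volume] 0 := by
    refine hw.ae_eq_zero_of_orthogonal ((memLp_const 1).sub (hnone.const_mul c)) fun e => ?_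
    have i1 : Integrable fun x => periodicWavelet φ ψ none x * periodicWavelet φ ψ e x :=
      hnone.integrable_mul (hw.memLp_periodicWavelet e)
    have heq : ∀ x, (1 - c * periodicWavelet φ ψ none x) * periodicWavelet φ ψ e x =
        periodicWavelet φ ψ e x -
          c * (periodicWavelet φ ψ none x * periodicWavelet φ ψ e x) := fun x => by ring
    simp_rw [heq]
    rw [integral_sub (hw.integrable_periodicWavelet e) (i1.const_mul c), integral_const_mul,
      hw.integral_periodicWavelet_mul]
    cases e with
    | none => simp [hc]
    | some a => simp [hw.integral_periodicWavelet_some a]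
  have h2 : c * c = 1 := by
    have h3 : ∫ x : I, (1 : ℝ) = ∫ x, c * periodicWavelet φ ψ none x := by
      refine integral_congr_ae ?_
      filter_upwards [h1] with x hx
      have hx : 1 - c * periodicWavelet φ ψ none x = 0 := hx
      linarith
    rw [integral_const_mul, ← hc] at h3
    simpa using h3.symm
  refine ⟨c, mul_self_eq_one_iff.1 h2, rfl, ?_⟩
  filter_upwards [h1] with x hx
  have hx : 1 - c * periodicWavelet φ ψ none x = 0 := hx
  calc periodicWavelet φ ψ none x = c * (c * periodicWavelet φ ψ none x) := by
        rw [← mul_assoc, h2, one_mul]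
    _ = c * 1 := by rw [show c * periodicWavelet φ ψ none x = 1 by linarith]
    _ = c := mul_one c

/-- Noise strictly below the threshold cannot offset the shrinkage. The sign `c` appears because the
periodized father wavelet may be -1. -/
lemma soft_mul_lt_one {t n c : ℝ} (hn : |n| < t) (hc : c = 1 ∨ c = -1) :
    soft t (n + c) * c < 1 := by
  have ht : 0 ≤ t := (abs_nonneg n).trans hn.le
  obtain ⟨h1, h2⟩ := abs_lt.1 hn
  rcases le_or_gt |n + c| t with h | h
  · rw [soft_of_abs_le h, zero_mul]
    exact one_pos
  rcases lt_abs.1 h with h | h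
  · rw [soft_of_lt ht h]
    rcases hc with rfl | rfl <;> linarith
  · rw [soft_of_lt_neg ht (by linarith)]
    rcases hc with rfl | rfl <;> linarith

/-- From samples of the constant `1` with small noise the reconstruction is a constant less
than `1`. -/
lemma IsWavelet.exists_reconstruct_ae_eq_const (hw : IsWavelet φ ψ) {sd : ℝ≥0} {J : ℕ}
    {z : Fin (2 ^ J) → ℝ} (hz : z ∈ smallNoise φ ψ sd J) :
    ∃ r < 1, reconstruct φ ψ sd J (fun i => 1 + z i) =ᵐ[volume] fun _ => r := by
  obtain ⟨c, hc, hcint, hcae⟩ := hw.exists_periodicWavelet_none_ae_eq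
  have hstep : ∀ e, ∫ x, step (fun _ : Fin (2 ^ J) => 1) x * periodicWavelet φ ψ e x =
      ∫ x, periodicWavelet φ ψ e x := by
    intro e
    refine integral_congr_ae ?_
    filter_upwards [ae_exists_mem_cell (Nat.two_pow_pos J)] with x ⟨i, hi⟩
    rw [step_of_mem_cell _ hi, one_mul]
  have hsome : ∀ a, some a ∈ waveletIndices J →
      coeff sd (fun i => 1 + z i) (periodicWavelet φ ψ (some a)) = 0 := by
    intro a ha
    rw [coeff_add sd (fun _ => 1) z (hw.integrable_periodicWavelet _), hstep,
      hw.integral_periodicWavelet_some, add_zero]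
    exact soft_of_abs_le (hz _ ha).le
  have hnone_mem : none ∈ waveletIndices J := Finset.none_mem_insertNone
  refine ⟨_, soft_mul_lt_one (hz none hnone_mem) hc, ?_⟩
  filter_upwards [hcae] with x hx
  rw [reconstruct_eq_sum, Finset.sum_eq_single none]
  · rw [hx, coeff_add sd (fun _ => 1) z (hw.integrable_periodicWavelet _), hstep, hcint]
  · rintro (_ | a) ha hne
    · exact absurd rfl hne
    · rw [hsome a ha, zero_mul]
  · exact fun h => absurd hnone_mem h

/-- For β = 1 the constraint at energy 1 is void. The reconstruction is a constant below 1, so no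
input meets the constraint and its capacity takes the value 0 of an empty supremum. -/
lemma infoLoss_one_eq (hw : IsWavelet φ ψ) (sd : ℝ≥0) (x : ∀ m : ℕ, Fin m → I) {J : ℕ}
    {z : Fin (2 ^ J) → ℝ} (hz : z ∈ smallNoise φ ψ sd J) :
    infoLoss κ cmax φ ψ sd x (fun _ => 1) 1 J z = (maxCapacity κ cmax).toReal := by
  obtain ⟨r, hr, hrae⟩ := hw.exists_reconstruct_ae_eq_const hz
  have h1 : capacity κ cmax (fun _ => 1) 1 = maxCapacity κ cmax :=
    le_antisymm (capacity_le_maxCapacity κ _ _ _) <| iSup₂_le fun p hp =>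
      mutualInfo_le_capacity κ hp (energy_const hp 1).ge
  have h2 : capacity κ cmax (reconstruct φ ψ sd J fun i => 1 + z i) 1 = 0 := by
    refine le_antisymm (iSup₂_le fun p hp => ?_) zero_le
    have h := hp.2
    rw [energy_congr_ae hrae, energy_const hp.1] at h
    exact absurd h (not_le.2 hr)
  rw [infoLoss, h1, h2, ENNReal.toReal_zero, sub_zero, abs_of_nonneg ENNReal.toReal_nonneg]

lemma eventually_le_expectedInfoLoss_one (hw : IsWavelet φ ψ) (hC : maxCapacity κ cmax ≠ ∞)
    {sd : ℝ≥0} (hsd : 0 < sd) (x : ∀ m : ℕ, Fin m → I) :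
    ∀ᶠ J in atTop, (maxCapacity κ cmax).toReal / 2 ≤
      expectedInfoLoss κ cmax φ ψ sd x (fun _ => 1) 1 J := by
  -- Once the small-noise event has probability at least 1/2, the expected loss is at least half the
  -- maximal capacity.
  filter_upwards [(hw.tendsto_noise_compl_smallNoise hsd).eventually_le_const
    (show (0 : ℝ) < 1 / 2 by norm_num)] with J hJ
  have hm := measurableSet_smallNoise φ ψ sd J
  refine le_trans ?_ (le_expectedInfoLoss κ hw hC hsd x (fun _ => 1) 1 hm
    fun z hz => (infoLoss_one_eq κ hw sd x hz).ge)
  rw [probReal_compl_eq_one_sub hm] at hJ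
  rw [div_eq_mul_one_div]
  exact mul_le_mul_of_nonneg_left (by linarith) ENNReal.toReal_nonneg

end SIET

end

/-! ### The theorem -/

theorem theorem5 {𝒴 : Type*} [MeasurableSpace 𝒴] (κ : Kernel I 𝒴) [IsMarkovKernel κ]
    (cmax : ℝ) (hC : SIET.maxCapacity κ cmax ≠ ∞)
    (φ ψ : ℝ → ℝ) (hw : SIET.IsWavelet φ ψ)
    (sd : ℝ≥0) (hsd : 0 < sd) (K : ℝ≥0)
    (x : ∀ m : ℕ, Fin m → I) (hx : x = SIET.regularGrid ∨ x = SIET.dyadicGrid) :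
    (∀ β ∈ SIET.BV K, ∀ B : ℝ, 0 ≤ B → B < SIET.maxEnergy cmax β →
      (∀ J, Integrable (SIET.infoLoss κ cmax φ ψ sd x β B J) (SIET.noise sd (2 ^ J))) ∧
      Tendsto (fun J => SIET.expectedInfoLoss κ cmax φ ψ sd x β B J) atTop (𝓝 0)) ∧
    (SIET.maxCapacity κ cmax ≠ 0 → ∃ β ∈ SIET.BV K, (∀ t, 0 ≤ β t) ∧
      ∃ c > 0, ∀ᶠ J in atTop,
        c ≤ SIET.expectedInfoLoss κ cmax φ ψ sd x β (SIET.maxEnergy cmax β) J) := by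
  refine ⟨fun β hβ B hB0 hB => ⟨fun J => hw.integrable_infoLoss κ hC hsd x β B J,
    SIET.tendsto_expectedInfoLoss κ hw hC hsd hx hβ hB0 hB⟩, fun h0 => ?_⟩
  -- A constant has variation 0, so this counterexample serves every `K`, including 0.
  refine ⟨fun _ => 1, SIET.const_mem_BV 1 K, fun _ => zero_le_one,
    (SIET.maxCapacity κ cmax).toReal / 2, half_pos (ENNReal.toReal_pos h0 hC), ?_⟩
  rw [SIET.maxEnergy_const (SIET.admissible_nonempty_of_maxCapacity_ne_zero κ h0)]
  exact SIET.eventually_le_expectedInfoLoss_one κ hw hC hsd x
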